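/- \textbf{Theorem (Denotational preciseness).} Fix a set of participants $\mathsf p,\mathsf q,\dots$ and a set of labels $\ell,\dots$ \emph{Types.} Sorts are $\mathtt{nat},\mathtt{int},\mathtt{bool}$; subsorting $<:$ is the reflexive-transitive closure of $\mathtt{nat}<:\mathtt{int}$. Session types are the closed terms of $$T ::= \textstyle\bigwedge_{i\in I}\mathsf p?\ell_i(S_i).T_i \;\mid\; \bigvee_{i\in I}\mathsf q!\ell_i(S_i).T_i \;\mid\; \mu\mathbf t.T \;\mid\; \mathbf t \;\mid\; \mathtt{end}$$ with $I$ finite and non-empty, with $\ell_i\neq\ell_j$ for $i\ne j$ in each intersection and each union, and with guarded recursion. Types with the same regular tree are identified. Subtyping $\leqslant$ is the relation defined coinductively by the rules: $\mathtt{end}\leqslant\mathtt{end}$; $\bigwedge_{i\in I\cup J}\mathsf p?\ell_i(S_i).T_i\leqslant\bigwedge_{i\in I}\mathsf p?\ell_i(S'_i).T'_i$ if $S'_i<:S_i$ and $T_i\leqslant T'_i$ for all $i\in I$; $\bigvee_{i\in I}\mathsf p!\ell_i(S_i).T_i\leqslant\bigvee_{i\in I\cup J}\mathsf p!\ell_i(S'_i).T'_i$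 if $S_i<:S'_i$ and $T_i\leqslant T'_i$ for all $i\in I$. \emph{Processes.} Expressions $e$ are variables, integers (among them the natural numbers), $\mathsf{true}$, $\mathsf{false}$, $\mathtt{succ}\,e$, $\mathtt{neg}\,e$, $\neg e$, $e\oplus e$ and $e>e$. Processes are $$P ::= \mathsf p?\ell(x).P \mid \mathsf q!\ell(e).P \mid P+P \mid \mathsf{if}\ e\ \mathsf{then}\ P\ \mathsf{else}\ P \mid \mu X.P \mid X \mid \mathbf 0$$ with recursion guarded by input or output prefixes; $\mu X.P$ and $P\{\mu X.P/X\}$ are identified. \emph{Typing.} $\Gamma\vdash e:S$ is given by: natural numbers have sort $\mathtt{nat}$, integers $\mathtt{int}$, $\mathsf{true},\mathsf{false}$ $\mathtt{bool}$, and variables their sort in $\Gamma$; $\mathtt{succ}:\mathtt{nat}\to\mathtt{nat}$, $\mathtt{neg}:\mathtt{int}\to\mathtt{int}$, $\neg:\mathtt{bool}\to\mathtt{bool}$, $\oplus:S\times S\to S$, ${>}:\mathtt{int}\times\mathtt{int}\to\mathtt{bool}$; and subsumption along $<:$. The judgement $\Gamma\vdash P:T$ is given inductively by: \begin{itemize}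 \item $\Gamma\vdash\sum_{i\in I}\mathsf q?\ell_i(x).P_i:\bigwedge_{i\in I}\mathsf q?\ell_i(S_i).T_i$ if $\Gamma,x:S_i\vdash P_i:T_i$ for all $i\in I$ (the $\ell_i$ pairwise distinct); \item $\Gamma\vdash\mathbf 0:\mathtt{end}$; \item $\Gamma\vdash\mathsf q!\ell(e).P:\mathsf q!\ell(S).T$ if $\Gamma\vdash e:S$ and $\Gamma\vdash P:T$; \item $\Gamma\vdash\mathsf{if}\ e\ \mathsf{then}\ P_1\ \mathsf{else}\ P_2:T_1\vee T_2$ if $\Gamma\vdash e:\mathtt{bool}$, $\Gamma\vdash P_1:T_1$, $\Gamma\vdash P_2:T_2$, where $T\vee T=T$ and otherwise $T_1,T_2$ are unions of outputs to the same participant with disjoint label sets; \item $\Gamma\vdash\mu X.P:T$ if $\Gamma,X:T\vdash P:T$; $\ \Gamma,X:T\vdash X:T$; and $\Gamma\vdash P:T'$ if $\Gamma\vdash P:T$ and $T\leqslant T'$. \end{itemize} Interpret a session type $T$ as the set of closed processes of that type, $[\![T]\!]=\{P\mid\ \vdash P:T\}$. Then for all session types $T,T'$: $$T\leqslant T'\quad\text{if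 and only if}\quad[\![T]\!]\subseteq[\![T']\!].$$ Moreover, for all session types $T,T'$, $\ \vdash\mathcal P(T):T'$ implies $T\leqslant T'$, where the characteristic process $\mathcal P(T)$ is defined by recursion on $T$: $\mathcal P(\bigwedge_{i\in I}\mathsf p?\ell_i(S_i).T_i)=\sum_{i\in I}\mathsf p?\ell_i(x).\mathsf{if}\ c_{S_i}\ \mathsf{then}\ \mathcal P(T_i)\ \mathsf{else}\ \mathcal P(T_i)$ with $c_{\mathtt{nat}}=(\mathtt{succ}\,x>0)$, $c_{\mathtt{int}}=(\mathtt{neg}\,x>0)$, $c_{\mathtt{bool}}=\neg x$; $\mathcal P(\mathsf p!\ell(S).T_1)=\mathsf p!\ell(v_S).\mathcal P(T_1)$ with $v_{\mathtt{nat}}=5$, $v_{\mathtt{int}}=-5$, $v_{\mathtt{bool}}=\mathsf{true}$; $\mathcal P(T_1\vee T_2)=\mathsf{if}\ \mathsf{true}\oplus\mathsf{false}\ \mathsf{then}\ \mathcal P(T_1)\ \mathsf{else}\ \mathcal P(T_2)$ (iterated to the right for unions of several outputs); $\mathcal P(\mu\mathbf t.T_1)=\mu X_{\mathbf t}.\mathcal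 P(T_1)$, $\mathcal P(\mathbf t)=X_{\mathbf t}$, $\mathcal P(\mathtt{end})=\mathbf 0$. -/

import Mathlib

namespace MPST

universe u v

/-! ### Sorts and expressions -/

/-- Sorts: `nat`, `int`, `bool`. -/
inductive Srt : Type
  | nat
  | int
  | bool

/-- The generating pair `nat <: int` of subsorting. -/
inductive SubsortGen : Srt → Srt → Prop
  | nat_int : SubsortGen Srt.nat Srt.int

/-- Subsorting: the reflexive and transitive closure of `nat <: int`. -/
def Subsort : Srt → Srt → Prop := Relation.ReflTransGen SubsortGen

/-- Expressions. Expression variables are de Bruijn indices. The number literals are the integers,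
the natural numbers being the nonnegative ones. -/
inductive Expr : Type
  | var (n : ℕ)
  | num (z : ℤ)
  | bool (b : Bool)
  | succ (e : Expr)
  | neg (e : Expr)
  | not (e : Expr)
  | choice (e₁ e₂ : Expr)
  | gt (e₁ e₂ : Expr)

/-- Renaming of expression variables. -/
def Expr.rename (f : ℕ → ℕ) : Expr → Expr
  | .var n => .var (f n)
  | .num z => .num z
  | .bool b => .bool b
  | .succ e => .succ (e.rename f)
  | .neg e => .neg (e.rename f)
  | .not e => .not (e.rename f)
  | .choice e₁ e₂ => .choice (e₁.rename f) (e₂.rename f)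
  | .gt e₁ e₂ => .gt (e₁.rename f) (e₂.rename f)

/-- Typing of expressions. Entry `n` of the list `Γ` is the sort of the expression variable `n`. -/
inductive ExprTyped (Γ : List Srt) : Expr → Srt → Prop
  | nat (n : ℕ) : ExprTyped Γ (.num (n : ℤ)) .nat
  | int (z : ℤ) : ExprTyped Γ (.num z) .int
  | bool (b : Bool) : ExprTyped Γ (.bool b) .bool
  | var {n : ℕ} {S : Srt} : Γ[n]? = some S → ExprTyped Γ (.var n) S
  | succ {e : Expr} : ExprTyped Γ e .nat → ExprTyped Γ (.succ e) .nat
  | neg {e : Expr} : ExprTyped Γ e .int → ExprTyped Γ (.neg e) .int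
  | not {e : Expr} : ExprTyped Γ e .bool → ExprTyped Γ (.not e) .bool
  | choice {e₁ e₂ : Expr} {S : Srt} :
      ExprTyped Γ e₁ S → ExprTyped Γ e₂ S → ExprTyped Γ (.choice e₁ e₂) S
  | gt {e₁ e₂ : Expr} :
      ExprTyped Γ e₁ .int → ExprTyped Γ e₂ .int → ExprTyped Γ (.gt e₁ e₂) .bool
  | sub {e : Expr} {S S' : Srt} : ExprTyped Γ e S → Subsort S S' → ExprTyped Γ e S'

/-! ### Processes

`Part` is the set of participants and `Lab` the set of labels. Processes are taken up to renaming
of bound variables: expression variables and process variables are de Bruijn indices, in two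
separate scopes. -/

/-- Lifting of a renaming under a binder. -/
def liftRen (f : ℕ → ℕ) : ℕ → ℕ
  | 0 => 0
  | n + 1 => f n + 1

/-- Raw processes. `recv p ℓ P` is `p?ℓ(x).P` and binds expression variable `0` in `P`;
`send q ℓ e P` is `q!ℓ(e).P`; `add` is external choice; `mu P` is `μX.P` and binds process
variable `0` in `P`; `nil` is the inactive process. -/
inductive Proc (Part : Type u) (Lab : Type v) : Type (max u v)
  | recv (p : Part) (ℓ : Lab) (P : Proc Part Lab)
  | send (q : Part) (ℓ : Lab) (e : Expr) (P : Proc Part Lab)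
  | add (P Q : Proc Part Lab)
  | cond (e : Expr) (P Q : Proc Part Lab)
  | mu (P : Proc Part Lab)
  | pvar (n : ℕ)
  | nil

namespace Proc

variable {Part : Type u} {Lab : Type v}

/-- Renaming of expression variables in a process. -/
def renameE : (ℕ → ℕ) → Proc Part Lab → Proc Part Lab
  | f, recv p ℓ P => recv p ℓ (P.renameE (liftRen f))
  | f, send q ℓ e P => send q ℓ (e.rename f) (P.renameE f)
  | f, add P Q => add (P.renameE f) (Q.renameE f)
  | f, cond e P Q => cond (e.rename f) (P.renameE f) (Q.renameE f)
  | f, mu P => mu (P.renameE f)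
  | _, pvar n => pvar n
  | _, nil => nil

/-- Renaming of process variables in a process. -/
def renameP : (ℕ → ℕ) → Proc Part Lab → Proc Part Lab
  | f, recv p ℓ P => recv p ℓ (P.renameP f)
  | f, send q ℓ e P => send q ℓ e (P.renameP f)
  | f, add P Q => add (P.renameP f) (Q.renameP f)
  | f, cond e P Q => cond e (P.renameP f) (Q.renameP f)
  | f, mu P => mu (P.renameP (liftRen f))
  | f, pvar n => pvar (f n)
  | _, nil => nil

/-- Lifting of a process substitution under the binder `μX`. -/
def liftSubst (σ : ℕ → Proc Part Lab) : ℕ → Proc Part Lab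
  | 0 => pvar 0
  | n + 1 => (σ n).renameP Nat.succ

/-- Capture-avoiding simultaneous substitution of processes for process variables. -/
def subst : (ℕ → Proc Part Lab) → Proc Part Lab → Proc Part Lab
  | σ, recv p ℓ P => recv p ℓ (P.subst fun n => (σ n).renameE Nat.succ)
  | σ, send q ℓ e P => send q ℓ e (P.subst σ)
  | σ, add P Q => add (P.subst σ) (Q.subst σ)
  | σ, cond e P Q => cond e (P.subst σ) (Q.subst σ)
  | σ, mu P => mu (P.subst (liftSubst σ))
  | σ, pvar n => σ n
  | _, nil => nil

/-- The substitution of `Q` for process variable `0`, the other variables being lowered. -/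
def instSubst (Q : Proc Part Lab) : ℕ → Proc Part Lab
  | 0 => Q
  | n + 1 => pvar n

/-- For `P` the body of `μX.P`: the unfolding `P{μX.P/X}`. -/
def unfold (P : Proc Part Lab) : Proc Part Lab := P.subst (instSubst (mu P))

/-- Process variable `n` has a free occurrence that is under no input or output prefix. -/
def Exposed : ℕ → Proc Part Lab → Prop
  | _, recv _ _ _ => False
  | _, send _ _ _ _ => False
  | n, add P Q => P.Exposed n ∨ Q.Exposed n
  | n, cond _ P Q => P.Exposed n ∨ Q.Exposed n
  | n, mu P => P.Exposed (n + 1)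
  | n, pvar m => m = n
  | _, nil => False

/-- All recursions in the process are guarded. -/
def Guarded : Proc Part Lab → Prop
  | recv _ _ P => P.Guarded
  | send _ _ _ P => P.Guarded
  | add P Q => P.Guarded ∧ Q.Guarded
  | cond _ P Q => P.Guarded ∧ Q.Guarded
  | mu P => ¬ P.Exposed 0 ∧ P.Guarded
  | pvar _ => True
  | nil => True

/-- The equi-recursive identification of processes: the least congruence that identifies `μX.P`
with its unfolding `P{μX.P/X}`. -/
inductive Equi : Proc Part Lab → Proc Part Lab → Prop
  | unfold (P : Proc Part Lab) : Equi (mu P) P.unfold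
  | refl (P : Proc Part Lab) : Equi P P
  | symm {P Q : Proc Part Lab} : Equi P Q → Equi Q P
  | trans {P Q R : Proc Part Lab} : Equi P Q → Equi Q R → Equi P R
  | recv (p : Part) (ℓ : Lab) {P Q : Proc Part Lab} :
      Equi P Q → Equi (recv p ℓ P) (recv p ℓ Q)
  | send (q : Part) (ℓ : Lab) (e : Expr) {P Q : Proc Part Lab} :
      Equi P Q → Equi (send q ℓ e P) (send q ℓ e Q)
  | add {P P' Q Q' : Proc Part Lab} : Equi P P' → Equi Q Q' → Equi (add P Q) (add P' Q')
  | cond (e : Expr) {P P' Q Q' : Proc Part Lab} :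
      Equi P P' → Equi Q Q' → Equi (cond e P Q) (cond e P' Q')
  | mu {P Q : Proc Part Lab} : Equi P Q → Equi (mu P) (mu Q)

/-- The summands `P₁, …, Pₙ` of an external choice `P₁ + … + Pₙ`, however it is bracketed. -/
def summands : Proc Part Lab → List (Proc Part Lab)
  | add P Q => P.summands ++ Q.summands
  | P => [P]

/-- The choice `P₀ + (P₁ + (… + Pₙ))`. -/
def sum : (n : ℕ) → (Fin (n + 1) → Proc Part Lab) → Proc Part Lab
  | 0, P => P 0
  | n + 1, P => add (P 0) (sum n fun i => P i.succ)

/-- The internal choice among `P₀, …, Pₙ`, by nested conditionals on `true ⊕ false`. -/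
def internal : (n : ℕ) → (Fin (n + 1) → Proc Part Lab) → Proc Part Lab
  | 0, P => P 0
  | n + 1, P =>
      cond (.choice (.bool true) (.bool false)) (P 0) (internal n fun i => P i.succ)

end Proc

/-! ### Session types -/

/-- Raw session types. `inter p n ℓ S T` is the intersection `⋀ p?ℓᵢ(Sᵢ).Tᵢ` and
`union q n ℓ S T` the union `⋁ q!ℓᵢ(Sᵢ).Tᵢ`, both over `0 ≤ i ≤ n`; `mu T` is `μt.T` and binds
type variable `0` in `T` (type variables are de Bruijn indices); `done` is the type `end`. -/
inductive Ty (Part : Type u) (Lab : Type v) : Type (max u v)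
  | inter (p : Part) (n : ℕ) (ℓ : Fin (n + 1) → Lab) (S : Fin (n + 1) → Srt)
      (T : Fin (n + 1) → Ty Part Lab)
  | union (q : Part) (n : ℕ) (ℓ : Fin (n + 1) → Lab) (S : Fin (n + 1) → Srt)
      (T : Fin (n + 1) → Ty Part Lab)
  | mu (T : Ty Part Lab)
  | tvar (n : ℕ)
  | done

namespace Ty

variable {Part : Type u} {Lab : Type v}

/-- Renaming of type variables. -/
def rename : (ℕ → ℕ) → Ty Part Lab → Ty Part Lab
  | f, inter p n ℓ S T => inter p n ℓ S fun i => (T i).rename f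
  | f, union q n ℓ S T => union q n ℓ S fun i => (T i).rename f
  | f, mu T => mu (T.rename (liftRen f))
  | f, tvar n => tvar (f n)
  | _, done => done

/-- Lifting of a type substitution under the binder `μt`. -/
def liftSubst (σ : ℕ → Ty Part Lab) : ℕ → Ty Part Lab
  | 0 => tvar 0
  | n + 1 => (σ n).rename Nat.succ

/-- Capture-avoiding simultaneous substitution of types for type variables. -/
def subst : (ℕ → Ty Part Lab) → Ty Part Lab → Ty Part Lab
  | σ, inter p n ℓ S T => inter p n ℓ S fun i => (T i).subst σ
  | σ, union q n ℓ S T => union q n ℓ S fun i => (T i).subst σ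
  | σ, mu T => mu (T.subst (liftSubst σ))
  | σ, tvar n => σ n
  | _, done => done

/-- The substitution of `U` for type variable `0`, the other variables being lowered. -/
def instSubst (U : Ty Part Lab) : ℕ → Ty Part Lab
  | 0 => U
  | n + 1 => tvar n

/-- For `T` the body of `μt.T`: the unfolding `T{μt.T/t}`. -/
def unfold (T : Ty Part Lab) : Ty Part Lab := T.subst (instSubst (mu T))

/-- All free type variables are below `k`. -/
def ClosedAt : ℕ → Ty Part Lab → Prop
  | k, inter _ _ _ _ T => ∀ i, (T i).ClosedAt k
  | k, union _ _ _ _ T => ∀ i, (T i).ClosedAt k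
  | k, mu T => T.ClosedAt (k + 1)
  | k, tvar n => n < k
  | _, done => True

/-- Type variable `n` has a free occurrence that is under no input or output. -/
def Exposed : ℕ → Ty Part Lab → Prop
  | _, inter _ _ _ _ _ => False
  | _, union _ _ _ _ _ => False
  | n, mu T => T.Exposed (n + 1)
  | n, tvar m => m = n
  | _, done => False

/-- All recursions in the type are guarded. -/
def Guarded : Ty Part Lab → Prop
  | inter _ _ _ _ T => ∀ i, (T i).Guarded
  | union _ _ _ _ T => ∀ i, (T i).Guarded
  | mu T => ¬ T.Exposed 0 ∧ T.Guarded
  | tvar _ => True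
  | done => True

/-- In every intersection and in every union the labels are pairwise distinct. -/
def DistinctLabels : Ty Part Lab → Prop
  | inter _ _ ℓ _ T => Function.Injective ℓ ∧ ∀ i, (T i).DistinctLabels
  | union _ _ ℓ _ T => Function.Injective ℓ ∧ ∀ i, (T i).DistinctLabels
  | mu T => T.DistinctLabels
  | tvar _ => True
  | done => True

/-- Session types: closed, guarded raw types with pairwise distinct labels in every
intersection and union. -/
structure IsSessionType (T : Ty Part Lab) : Prop where
  closed : T.ClosedAt 0
  guarded : T.Guarded
  distinctLabels : T.DistinctLabels

/-- `Unfolds T H`: unfolding the leading recursions of `T` gives `H`, which is an intersection,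
a union, or `end`; that is, `H` shows the root of the regular tree of `T`. -/
inductive Unfolds : Ty Part Lab → Ty Part Lab → Prop
  | inter (p : Part) (n : ℕ) (ℓ : Fin (n + 1) → Lab) (S : Fin (n + 1) → Srt)
      (T : Fin (n + 1) → Ty Part Lab) : Unfolds (inter p n ℓ S T) (inter p n ℓ S T)
  | union (q : Part) (n : ℕ) (ℓ : Fin (n + 1) → Lab) (S : Fin (n + 1) → Srt)
      (T : Fin (n + 1) → Ty Part Lab) : Unfolds (union q n ℓ S T) (union q n ℓ S T)
  | done : Unfolds done done
  | mu {T H : Ty Part Lab} : Unfolds T.unfold H → Unfolds (mu T) H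

/-- One backward step of the subtyping rules, with `R` for the subtyping of the continuations. -/
inductive SubStep (R : Ty Part Lab → Ty Part Lab → Prop) : Ty Part Lab → Ty Part Lab → Prop
  | done {T T' : Ty Part Lab} : Unfolds T done → Unfolds T' done → SubStep R T T'
  | inter {T T' : Ty Part Lab} (p : Part) {n n' : ℕ}
      {ℓ : Fin (n + 1) → Lab} {S : Fin (n + 1) → Srt} {U : Fin (n + 1) → Ty Part Lab}
      {ℓ' : Fin (n' + 1) → Lab} {S' : Fin (n' + 1) → Srt} {U' : Fin (n' + 1) → Ty Part Lab} :
      Unfolds T (inter p n ℓ S U) → Unfolds T' (inter p n' ℓ' S' U') →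
      (∀ i, ∃ j, ℓ j = ℓ' i ∧ Subsort (S' i) (S j) ∧ R (U j) (U' i)) → SubStep R T T'
  | union {T T' : Ty Part Lab} (q : Part) {n n' : ℕ}
      {ℓ : Fin (n + 1) → Lab} {S : Fin (n + 1) → Srt} {U : Fin (n + 1) → Ty Part Lab}
      {ℓ' : Fin (n' + 1) → Lab} {S' : Fin (n' + 1) → Srt} {U' : Fin (n' + 1) → Ty Part Lab} :
      Unfolds T (union q n ℓ S U) → Unfolds T' (union q n' ℓ' S' U') →
      (∀ i, ∃ j, ℓ i = ℓ' j ∧ Subsort (S i) (S' j) ∧ R (U i) (U' j)) → SubStep R T T'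

/-- Subtyping: the largest relation closed backward under the subtyping rules, which are read
coinductively on the regular trees of the types. -/
def Subtype (T T' : Ty Part Lab) : Prop :=
  ∃ R : Ty Part Lab → Ty Part Lab → Prop, (∀ U U', R U U' → SubStep R U U') ∧ R T T'

/-- `IsJoin T₁ T₂ T`: `T` is `T₁ ∨ T₂`. Two copies of one type have that type as their union, and
two unions of outputs to the same participant have the union of all their branches. (Distinctness
of the labels is part of `T` being a session type.) -/
inductive IsJoin : Ty Part Lab → Ty Part Lab → Ty Part Lab → Prop
  | idem (T : Ty Part Lab) : IsJoin T T T
  | union (q : Part) {n₁ n₂ n : ℕ}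
      {ℓ₁ : Fin (n₁ + 1) → Lab} {S₁ : Fin (n₁ + 1) → Srt} {T₁ : Fin (n₁ + 1) → Ty Part Lab}
      {ℓ₂ : Fin (n₂ + 1) → Lab} {S₂ : Fin (n₂ + 1) → Srt} {T₂ : Fin (n₂ + 1) → Ty Part Lab}
      {ℓ : Fin (n + 1) → Lab} {S : Fin (n + 1) → Srt} {T : Fin (n + 1) → Ty Part Lab}
      (ι : Fin (n₁ + 1) ⊕ Fin (n₂ + 1) ≃ Fin (n + 1))
      (hℓ : ∀ s, ℓ (ι s) = Sum.elim ℓ₁ ℓ₂ s) (hS : ∀ s, S (ι s) = Sum.elim S₁ S₂ s)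
      (hT : ∀ s, T (ι s) = Sum.elim T₁ T₂ s) :
      IsJoin (union q n₁ ℓ₁ S₁ T₁) (union q n₂ ℓ₂ S₂ T₂) (union q n ℓ S T)

end Ty

/-! ### Typing of processes -/

section Typing

variable {Part : Type u} {Lab : Type v}

/-- Typing of processes, `Γ; Δ ⊢ P : T`. The environment is split into the sorts `Γ` of the
expression variables and the session types `Δ` of the process variables. The last rule expresses
that processes are identified with their unfoldings. -/
inductive Typed : List Srt → List (Ty Part Lab) → Proc Part Lab → Ty Part Lab → Prop
  | inChoice {Γ : List Srt} {Δ : List (Ty Part Lab)} {P : Proc Part Lab} (q : Part) {n : ℕ}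
      {ℓ : Fin (n + 1) → Lab} {S : Fin (n + 1) → Srt} {T : Fin (n + 1) → Ty Part Lab}
      {Q : Fin (n + 1) → Proc Part Lab} :
      P.summands = List.ofFn (fun i => Proc.recv q (ℓ i) (Q i)) → Function.Injective ℓ →
      (∀ i, Typed (S i :: Γ) Δ (Q i) (T i)) → Typed Γ Δ P (.inter q n ℓ S T)
  | nil {Γ : List Srt} {Δ : List (Ty Part Lab)} : Typed Γ Δ .nil .done
  | out {Γ : List Srt} {Δ : List (Ty Part Lab)} (q : Part) (ℓ : Lab) {e : Expr} {S : Srt}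
      {P : Proc Part Lab} {T : Ty Part Lab} :
      ExprTyped Γ e S → Typed Γ Δ P T →
      Typed Γ Δ (.send q ℓ e P) (.union q 0 (fun _ => ℓ) (fun _ => S) (fun _ => T))
  | cond {Γ : List Srt} {Δ : List (Ty Part Lab)} {e : Expr} {P₁ P₂ : Proc Part Lab}
      {T₁ T₂ T : Ty Part Lab} :
      ExprTyped Γ e .bool → Typed Γ Δ P₁ T₁ → Typed Γ Δ P₂ T₂ →
      Ty.IsJoin T₁ T₂ T → T.IsSessionType → Typed Γ Δ (.cond e P₁ P₂) T
  | recur {Γ : List Srt} {Δ : List (Ty Part Lab)} {P : Proc Part Lab} {T : Ty Part Lab} :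
      T.IsSessionType → Typed Γ (T :: Δ) P T → Typed Γ Δ (.mu P) T
  | pvar {Γ : List Srt} {Δ : List (Ty Part Lab)} {n : ℕ} {T : Ty Part Lab} :
      Δ[n]? = some T → Typed Γ Δ (.pvar n) T
  | sub {Γ : List Srt} {Δ : List (Ty Part Lab)} {P : Proc Part Lab} {T T' : Ty Part Lab} :
      Typed Γ Δ P T → T.Subtype T' → T'.IsSessionType → Typed Γ Δ P T'
  | equi {Γ : List Srt} {Δ : List (Ty Part Lab)} {P Q : Proc Part Lab} {T : Ty Part Lab} :
      Typed Γ Δ P T → Proc.Equi P Q → Typed Γ Δ Q T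

/-- The interpretation `⟦T⟧`: the set of (guarded) processes that have type `T` in the empty
environment; such processes are closed. -/
def denotation (T : Ty Part Lab) : Set (Proc Part Lab) :=
  {P | P.Guarded ∧ Typed [] [] P T}

/-- The test of a received value `x` (expression variable `0`) against a sort:
`succ x > 0`, `neg x > 0`, `¬ x`. -/
def sortTest : Srt → Expr
  | .nat => .gt (.succ (.var 0)) (.num 0)
  | .int => .gt (.neg (.var 0)) (.num 0)
  | .bool => .not (.var 0)

/-- The value sent by a characteristic process: `5`, `-5`, `true`. -/
def sortValue : Srt → Expr
  | .nat => .num 5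
  | .int => .num (-5)
  | .bool => .bool true

/-- The characteristic process of a type. The type variable `t` becomes the process variable with
the same index, and the continuations do not use the bound expression variables. -/
def charProc : Ty Part Lab → Proc Part Lab
  | .inter p n ℓ S T =>
      Proc.sum n fun i =>
        .recv p (ℓ i) (.cond (sortTest (S i)) (charProc (T i)) (charProc (T i)))
  | .union q n ℓ S T =>
      Proc.internal n fun i => .send q (ℓ i) (sortValue (S i)) (charProc (T i))
  | .mu T => .mu (charProc T)
  | .tvar n => .pvar n
  | .done => .nil

end Typing

end MPST

/-!
Subtyping implies inclusion of denotations by the subsumption rule. For the converse it is enough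
that the characteristic process of `T` is a guarded process of type `T`
(`MPST.charProc_mem_denotation`) and that each of its types `T'` satisfies `T ≤ T'`
(`MPST.subtype_of_headTyped_charProc`).

The latter needs the typing judgement to be inverted, which the identification of processes with
their unfoldings obstructs: a derivation may pass through arbitrary identified processes. The head
normal form `MPST.Proc.hnf` unfolds the recursions that are under no prefix. Guardedness is
invariant under the identification, and identified guarded processes have head normal forms with
the same shape and with identified continuations (`MPST.Proc.Equi.headEquiv_hnf`). Hence, by the
substitution lemma, a guarded process of type `T` has a head normal form of type `T` in the system
`MPST.HeadTyped`, where recursion and identification play no part above the first prefixes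
(`MPST.Typed.headTyped_hnf`), and inversion is an induction on derivations.

Inverting a typing at `T'` of the head normal form of the characteristic process of `T` exhibits
the root of `T'`: an input, an output or `end`, as at the root of `T`, with the required labels. The
tests on received values and the values sent force the inequalities between sorts, and the
continuations are again characteristic processes. So the pairs of types related in this way are
closed backward under the subtyping rules.
-/

namespace MPST

universe u v

/-! ### Renaming and substitution in processes -/

theorem liftRen_comp (f g : ℕ → ℕ) : liftRen g ∘ liftRen f = liftRen (g ∘ f) := by
  funext n; cases n <;> rfl

theorem Expr.rename_rename (f g : ℕ → ℕ) (e : Expr) :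
    (e.rename f).rename g = e.rename (g ∘ f) := by
  induction e <;> simp_all [Expr.rename]

namespace Proc

variable {Part : Type u} {Lab : Type v}

theorem renameE_renameE (f g : ℕ → ℕ) (P : Proc Part Lab) :
    (P.renameE f).renameE g = P.renameE (g ∘ f) := by
  induction P generalizing f g <;> simp_all [renameE, Expr.rename_rename, liftRen_comp]

theorem renameP_renameP (f g : ℕ → ℕ) (P : Proc Part Lab) :
    (P.renameP f).renameP g = P.renameP (g ∘ f) := by
  induction P generalizing f g <;> simp_all [renameP, liftRen_comp]

theorem renameE_renameP (f g : ℕ → ℕ) (P : Proc Part Lab) :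
    (P.renameE f).renameP g = (P.renameP g).renameE f := by
  induction P generalizing f g <;> simp_all [renameP, renameE]

theorem renameE_succ_comm (f : ℕ → ℕ) (P : Proc Part Lab) :
    (P.renameE f).renameE Nat.succ = (P.renameE Nat.succ).renameE (liftRen f) := by
  rw [renameE_renameE, renameE_renameE]; rfl

theorem renameP_succ_comm (f : ℕ → ℕ) (P : Proc Part Lab) :
    (P.renameP f).renameP Nat.succ = (P.renameP Nat.succ).renameP (liftRen f) := by
  rw [renameP_renameP, renameP_renameP]; rfl

theorem liftSubst_renameE (f : ℕ → ℕ) (σ : ℕ → Proc Part Lab) :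
    liftSubst (fun n => (σ n).renameE f) = fun n => (liftSubst σ n).renameE f := by
  funext n; cases n
  · rfl
  · simp [liftSubst, renameE_renameP]

theorem subst_renameE (f : ℕ → ℕ) (σ : ℕ → Proc Part Lab) (P : Proc Part Lab) :
    (P.subst σ).renameE f = (P.renameE f).subst fun n => (σ n).renameE f := by
  induction P generalizing f σ <;>
    simp_all [subst, renameE, renameE_succ_comm, liftSubst_renameE]

theorem liftSubst_comp_liftRen (f : ℕ → ℕ) (σ : ℕ → Proc Part Lab) :
    (fun n => liftSubst σ (liftRen f n)) = liftSubst fun n => σ (f n) := by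
  funext n; cases n <;> rfl

theorem renameP_subst (f : ℕ → ℕ) (σ : ℕ → Proc Part Lab) (P : Proc Part Lab) :
    (P.renameP f).subst σ = P.subst fun n => σ (f n) := by
  induction P generalizing f σ <;>
    simp_all [subst, renameP, liftSubst_comp_liftRen]

theorem liftSubst_renameP (f : ℕ → ℕ) (σ : ℕ → Proc Part Lab) :
    (fun n => (liftSubst σ n).renameP (liftRen f)) = liftSubst fun n => (σ n).renameP f := by
  funext n; cases n
  · rfl
  · simp [liftSubst, renameP_succ_comm]

theorem subst_renameP (f : ℕ → ℕ) (σ : ℕ → Proc Part Lab) (P : Proc Part Lab) :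
    (P.subst σ).renameP f = P.subst fun n => (σ n).renameP f := by
  induction P generalizing f σ <;>
    simp_all [subst, renameP, liftSubst_renameP, renameE_renameP]

theorem liftSubst_subst (σ τ : ℕ → Proc Part Lab) :
    (fun n => (liftSubst σ n).subst (liftSubst τ)) = liftSubst fun n => (σ n).subst τ := by
  funext n; cases n
  · rfl
  · simp [liftSubst, renameP_subst, subst_renameP]

theorem subst_subst (σ τ : ℕ → Proc Part Lab) (P : Proc Part Lab) :
    (P.subst σ).subst τ = P.subst fun n => (σ n).subst τ := by
  induction P generalizing σ τ <;>
    simp_all [subst, liftSubst_subst, subst_renameE]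

theorem liftSubst_pvar : liftSubst (pvar : ℕ → Proc Part Lab) = pvar := by
  funext n; cases n <;> rfl

theorem subst_pvar (P : Proc Part Lab) : P.subst pvar = P := by
  induction P <;> simp_all [subst, liftSubst_pvar, renameE]

theorem renameP_eq_subst (f : ℕ → ℕ) (P : Proc Part Lab) :
    P.renameP f = P.subst fun n => pvar (f n) := by
  have h := subst_renameP f pvar P
  rwa [subst_pvar] at h

/-- Substituting under the binder and then instantiating it amounts to one substitution. -/
theorem liftSubst_instSubst (σ : ℕ → Proc Part Lab) (P Q : Proc Part Lab) :
    (P.subst (liftSubst σ)).subst (instSubst (Q.subst σ)) =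
      (P.subst (instSubst Q)).subst σ := by
  rw [subst_subst, subst_subst]
  congr 1
  funext n
  cases n with
  | zero => rfl
  | succ n =>
    simp only [liftSubst, renameP_subst, instSubst, subst]
    exact subst_pvar _

theorem unfold_subst (σ : ℕ → Proc Part Lab) (P : Proc Part Lab) :
    P.unfold.subst σ = (P.subst (liftSubst σ)).unfold :=
  (liftSubst_instSubst σ P (mu P)).symm

theorem unfold_renameE (f : ℕ → ℕ) (P : Proc Part Lab) :
    P.unfold.renameE f = (P.renameE f).unfold := by
  unfold unfold
  rw [subst_renameE]
  congr 1
  funext n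
  cases n <;> rfl

/-! ### Guardedness -/

theorem exposed_renameE (f : ℕ → ℕ) (n : ℕ) (P : Proc Part Lab) :
    (P.renameE f).Exposed n ↔ P.Exposed n := by
  induction P generalizing f n <;> simp_all [renameE, Exposed]

theorem guarded_renameE (f : ℕ → ℕ) (P : Proc Part Lab) :
    (P.renameE f).Guarded ↔ P.Guarded := by
  induction P generalizing f <;> simp_all [renameE, Guarded, exposed_renameE]

theorem exposed_renameP (f : ℕ → ℕ) (n : ℕ) (P : Proc Part Lab) :
    (P.renameP f).Exposed n ↔ ∃ m, f m = n ∧ P.Exposed m := by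
  induction P generalizing f n with
  | mu P ih =>
    simp only [renameP, Exposed, ih]
    constructor
    · rintro ⟨m, hm, h⟩
      cases m with
      | zero => simp [liftRen] at hm
      | succ m => exact ⟨m, by simpa [liftRen] using hm, h⟩
    · rintro ⟨m, rfl, h⟩
      exact ⟨m + 1, rfl, h⟩
  | add P Q ihP ihQ => simp [renameP, Exposed, ihP, ihQ, and_or_left, exists_or]
  | cond e P Q ihP ihQ => simp [renameP, Exposed, ihP, ihQ, and_or_left, exists_or]
  | _ => simp [renameP, Exposed]

theorem not_exposed_zero_renameP_succ (P : Proc Part Lab) :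
    ¬ (P.renameP Nat.succ).Exposed 0 := by
  simp [exposed_renameP]

theorem exposed_succ_renameP_succ (n : ℕ) (P : Proc Part Lab) :
    (P.renameP Nat.succ).Exposed (n + 1) ↔ P.Exposed n := by
  simp [exposed_renameP]

theorem guarded_renameP (f : ℕ → ℕ) (P : Proc Part Lab) :
    (P.renameP f).Guarded ↔ P.Guarded := by
  induction P generalizing f with
  | mu P ih =>
    have h : (∃ m, liftRen f m = 0 ∧ P.Exposed m) ↔ P.Exposed 0 := by
      constructor
      · rintro ⟨m, hm, h⟩
        cases m with
        | zero => exact h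
        | succ m => simp [liftRen] at hm
      · exact fun h => ⟨0, rfl, h⟩
    simp [renameP, Guarded, ih, exposed_renameP, h]
  | _ => simp_all [renameP, Guarded]

theorem exposed_subst (σ : ℕ → Proc Part Lab) (n : ℕ) (P : Proc Part Lab) :
    (P.subst σ).Exposed n ↔ ∃ m, P.Exposed m ∧ (σ m).Exposed n := by
  induction P generalizing σ n with
  | mu P ih =>
    simp only [subst, Exposed, ih]
    constructor
    · rintro ⟨m, hm, h⟩
      cases m with
      | zero => simp [liftSubst, Exposed] at h
      | succ m => exact ⟨m, hm, (exposed_succ_renameP_succ _ _).1 h⟩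
    · rintro ⟨m, hm, h⟩
      exact ⟨m + 1, hm, (exposed_succ_renameP_succ _ _).2 h⟩
  | add P Q ihP ihQ => simp [subst, Exposed, ihP, ihQ, or_and_right, exists_or]
  | cond e P Q ihP ihQ => simp [subst, Exposed, ihP, ihQ, or_and_right, exists_or]
  | _ => simp [subst, Exposed]

theorem exposed_zero_subst_liftSubst (σ : ℕ → Proc Part Lab) (P : Proc Part Lab) :
    (P.subst (liftSubst σ)).Exposed 0 ↔ P.Exposed 0 := by
  rw [exposed_subst]
  constructor
  · rintro ⟨m, hm, h⟩
    cases m with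
    | zero => exact hm
    | succ m => exact absurd h (not_exposed_zero_renameP_succ _)
  · exact fun h => ⟨0, h, rfl⟩

theorem Guarded.subst {σ : ℕ → Proc Part Lab} {P : Proc Part Lab} (hP : P.Guarded)
    (hσ : ∀ n, (σ n).Guarded) : (P.subst σ).Guarded := by
  induction P generalizing σ with
  | mu P ih =>
    refine ⟨(exposed_zero_subst_liftSubst σ P).not.2 hP.1, ih hP.2 fun n => ?_⟩
    cases n with
    | zero => trivial
    | succ n => exact (guarded_renameP _ _).2 (hσ n)
  | recv p ℓ P ih => exact ih hP fun n => (guarded_renameE _ _).2 (hσ n)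
  | send q ℓ e P ih => exact ih hP hσ
  | add P Q ihP ihQ => exact ⟨ihP hP.1 hσ, ihQ hP.2 hσ⟩
  | cond e P Q ihP ihQ => exact ⟨ihP hP.1 hσ, ihQ hP.2 hσ⟩
  | pvar n => exact hσ n
  | nil => trivial

theorem Guarded.of_subst {σ : ℕ → Proc Part Lab} {P : Proc Part Lab}
    (h : (P.subst σ).Guarded) : P.Guarded := by
  induction P generalizing σ with
  | mu P ih => exact ⟨(exposed_zero_subst_liftSubst σ P).not.1 h.1, ih h.2⟩
  | recv p ℓ P ih => exact ih h
  | send q ℓ e P ih => exact ih h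
  | add P Q ihP ihQ => exact ⟨ihP h.1, ihQ h.2⟩
  | cond e P Q ihP ihQ => exact ⟨ihP h.1, ihQ h.2⟩
  | pvar n => trivial
  | nil => trivial

theorem Guarded.of_subst_exposed {σ : ℕ → Proc Part Lab} {P : Proc Part Lab} {n : ℕ}
    (h : (P.subst σ).Guarded) (hn : P.Exposed n) : (σ n).Guarded := by
  induction P generalizing σ n with
  | mu P ih => exact (guarded_renameP _ _).1 (ih h.2 hn)
  | recv p ℓ P ih => exact hn.elim
  | send q ℓ e P ih => exact hn.elim
  | add P Q ihP ihQ => exact hn.elim (ihP h.1) (ihQ h.2)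
  | cond e P Q ihP ihQ => exact hn.elim (ihP h.1) (ihQ h.2)
  | pvar m => cases hn; exact h
  | nil => exact hn.elim

theorem exposed_unfold (n : ℕ) (P : Proc Part Lab) :
    P.unfold.Exposed n ↔ (mu P).Exposed n := by
  rw [unfold, exposed_subst]
  constructor
  · rintro ⟨m, hm, h⟩
    cases m with
    | zero => exact h
    | succ m => cases h; exact hm
  · exact fun h => ⟨n + 1, h, rfl⟩

/-- Unfolding an unguarded recursion leaves a copy of it unguarded, so guardedness is reflected by
unfolding as well as preserved. -/
theorem guarded_unfold (P : Proc Part Lab) : P.unfold.Guarded ↔ (mu P).Guarded := by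
  constructor
  · exact fun h => ⟨fun h0 => (h.of_subst_exposed h0).1 h0, h.of_subst⟩
  · intro h
    refine h.2.subst fun n => ?_
    cases n with
    | zero => exact h
    | succ n => trivial

theorem Equi.exposed_iff {P Q : Proc Part Lab} (h : Equi P Q) (n : ℕ) :
    P.Exposed n ↔ Q.Exposed n := by
  induction h generalizing n with
  | unfold P => exact (exposed_unfold n P).symm
  | refl => exact Iff.rfl
  | symm _ ih => exact (ih n).symm
  | trans _ _ ih₁ ih₂ => exact (ih₁ n).trans (ih₂ n)
  | recv => exact Iff.rfl
  | send => exact Iff.rfl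
  | add _ _ ih₁ ih₂ => exact or_congr (ih₁ n) (ih₂ n)
  | cond _ _ _ ih₁ ih₂ => exact or_congr (ih₁ n) (ih₂ n)
  | mu _ ih => exact ih (n + 1)

theorem Equi.guarded_iff {P Q : Proc Part Lab} (h : Equi P Q) : P.Guarded ↔ Q.Guarded := by
  induction h with
  | unfold P => exact (guarded_unfold P).symm
  | refl => exact Iff.rfl
  | symm _ ih => exact ih.symm
  | trans _ _ ih₁ ih₂ => exact ih₁.trans ih₂
  | recv _ _ _ ih => exact ih
  | send _ _ _ _ ih => exact ih
  | add _ _ ih₁ ih₂ => exact and_congr ih₁ ih₂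
  | cond _ _ _ ih₁ ih₂ => exact and_congr ih₁ ih₂
  | mu h ih => exact and_congr (h.exposed_iff 0).not ih

/-! ### The equi-recursive identification under substitution -/

theorem Equi.renameE {P Q : Proc Part Lab} (h : Equi P Q) (f : ℕ → ℕ) :
    Equi (P.renameE f) (Q.renameE f) := by
  induction h generalizing f with
  | unfold P => rw [unfold_renameE]; exact .unfold _
  | refl => exact .refl _
  | symm _ ih => exact (ih f).symm
  | trans _ _ ih₁ ih₂ => exact (ih₁ f).trans (ih₂ f)
  | recv p ℓ _ ih => exact .recv p ℓ (ih _)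
  | send q ℓ e _ ih => exact .send q ℓ _ (ih f)
  | add _ _ ih₁ ih₂ => exact .add (ih₁ f) (ih₂ f)
  | cond e _ _ ih₁ ih₂ => exact .cond _ (ih₁ f) (ih₂ f)
  | mu _ ih => exact .mu (ih f)

theorem Equi.subst {P Q : Proc Part Lab} (h : Equi P Q) (σ : ℕ → Proc Part Lab) :
    Equi (P.subst σ) (Q.subst σ) := by
  induction h generalizing σ with
  | unfold P => rw [unfold_subst]; exact .unfold _
  | refl => exact .refl _
  | symm _ ih => exact (ih σ).symm
  | trans _ _ ih₁ ih₂ => exact (ih₁ σ).trans (ih₂ σ)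
  | recv p ℓ _ ih => exact .recv p ℓ (ih _)
  | send q ℓ e _ ih => exact .send q ℓ _ (ih σ)
  | add _ _ ih₁ ih₂ => exact .add (ih₁ σ) (ih₂ σ)
  | cond e _ _ ih₁ ih₂ => exact .cond _ (ih₁ σ) (ih₂ σ)
  | mu _ ih => exact .mu (ih _)

theorem Equi.renameP {P Q : Proc Part Lab} (h : Equi P Q) (f : ℕ → ℕ) :
    Equi (P.renameP f) (Q.renameP f) := by
  rw [renameP_eq_subst, renameP_eq_subst]; exact h.subst _

theorem equi_liftSubst {σ τ : ℕ → Proc Part Lab} (h : ∀ n, Equi (σ n) (τ n)) (n : ℕ) :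
    Equi (liftSubst σ n) (liftSubst τ n) := by
  cases n with
  | zero => exact .refl _
  | succ n => exact (h n).renameP _

theorem equi_subst_right {σ τ : ℕ → Proc Part Lab} (h : ∀ n, Equi (σ n) (τ n))
    (P : Proc Part Lab) : Equi (P.subst σ) (P.subst τ) := by
  induction P generalizing σ τ with
  | mu P ih => exact .mu (ih (equi_liftSubst h))
  | recv p ℓ P ih => exact .recv p ℓ (ih fun n => (h n).renameE _)
  | send q ℓ e P ih => exact .send q ℓ e (ih h)
  | add P Q ihP ihQ => exact .add (ihP h) (ihQ h)
  | cond e P Q ihP ihQ => exact .cond e (ihP h) (ihQ h)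
  | pvar n => exact h n
  | nil => exact .refl _

theorem Equi.subst_congr {P Q : Proc Part Lab} (hPQ : Equi P Q) {σ τ : ℕ → Proc Part Lab}
    (h : ∀ n, Equi (σ n) (τ n)) : Equi (P.subst σ) (Q.subst τ) :=
  (hPQ.subst σ).trans (equi_subst_right h Q)

/-! ### Head normal forms of processes -/

/-- The head normal form: every recursion that is under no prefix is unfolded. Since recursions are
meant to be guarded, `μX.P` may be unfolded after its body has been brought into head normal form,
which makes the definition structurally recursive. -/
def hnf : Proc Part Lab → Proc Part Lab
  | recv p ℓ P => recv p ℓ P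
  | send q ℓ e P => send q ℓ e P
  | add P Q => add P.hnf Q.hnf
  | cond e P Q => cond e P.hnf Q.hnf
  | mu P => P.hnf.subst (instSubst (mu P))
  | pvar n => pvar n
  | nil => nil

theorem exposed_of_hnf {P : Proc Part Lab} {n : ℕ} (h : P.hnf.Exposed n) : P.Exposed n := by
  induction P generalizing n with
  | mu P ih =>
    obtain ⟨m, hm, h⟩ := (exposed_subst _ _ _).1 h
    cases m with
    | zero => exact h
    | succ m => cases h; exact ih hm
  | add P Q ihP ihQ => exact h.imp ihP ihQ
  | cond e P Q ihP ihQ => exact h.imp ihP ihQ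
  | _ => exact h

theorem hnf_renameP (f : ℕ → ℕ) (P : Proc Part Lab) :
    (P.renameP f).hnf = P.hnf.renameP f := by
  induction P generalizing f with
  | mu P ih =>
    simp only [renameP, hnf, ih, renameP_subst, subst_renameP]
    congr 1
    funext n
    cases n <;> rfl
  | _ => simp_all [renameP, hnf]

/-- Head normalization commutes with a substitution that puts only head normal forms in exposed
positions. -/
theorem hnf_subst {σ : ℕ → Proc Part Lab} {P : Proc Part Lab}
    (h : ∀ n, P.Exposed n → (σ n).hnf = σ n) : (P.subst σ).hnf = P.hnf.subst σ := by
  induction P generalizing σ with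
  | mu P ih =>
    have hP : (P.subst (liftSubst σ)).hnf = P.hnf.subst (liftSubst σ) := by
      refine ih fun n hn => ?_
      cases n with
      | zero => rfl
      | succ n => simp only [liftSubst, hnf_renameP, h n hn]
    simp only [subst, hnf, hP]
    exact liftSubst_instSubst σ P.hnf (mu P)
  | add P Q ihP ihQ =>
    simp only [subst, hnf]
    rw [ihP fun n hn => h n (.inl hn), ihQ fun n hn => h n (.inr hn)]
  | cond e P Q ihP ihQ =>
    simp only [subst, hnf]
    rw [ihP fun n hn => h n (.inl hn), ihQ fun n hn => h n (.inr hn)]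
  | pvar n => exact h n rfl
  | _ => rfl

theorem hnf_unfold {P : Proc Part Lab} (h : ¬ P.Exposed 0) : P.unfold.hnf = (mu P).hnf := by
  refine hnf_subst fun n hn => ?_
  cases n with
  | zero => exact absurd hn h
  | succ n => rfl

/-- Two processes have the same shape down to the first prefixes, and identified continuations
below them. -/
inductive HeadEquiv : Proc Part Lab → Proc Part Lab → Prop
  | recv (p : Part) (ℓ : Lab) {P Q : Proc Part Lab} :
      Equi P Q → HeadEquiv (recv p ℓ P) (recv p ℓ Q)
  | send (q : Part) (ℓ : Lab) (e : Expr) {P Q : Proc Part Lab} :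
      Equi P Q → HeadEquiv (send q ℓ e P) (send q ℓ e Q)
  | add {P P' Q Q' : Proc Part Lab} :
      HeadEquiv P P' → HeadEquiv Q Q' → HeadEquiv (add P Q) (add P' Q')
  | cond (e : Expr) {P P' Q Q' : Proc Part Lab} :
      HeadEquiv P P' → HeadEquiv Q Q' → HeadEquiv (cond e P Q) (cond e P' Q')
  | mu {P Q : Proc Part Lab} : Equi P Q → HeadEquiv (mu P) (mu Q)
  | pvar (n : ℕ) : HeadEquiv (pvar n) (pvar n)
  | nil : HeadEquiv nil nil

theorem HeadEquiv.refl (P : Proc Part Lab) : HeadEquiv P P := by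
  induction P with
  | recv p ℓ P => exact .recv p ℓ (.refl P)
  | send q ℓ e P => exact .send q ℓ e (.refl P)
  | add P Q ihP ihQ => exact .add ihP ihQ
  | cond e P Q ihP ihQ => exact .cond e ihP ihQ
  | mu P => exact .mu (.refl P)
  | pvar n => exact .pvar n
  | nil => exact .nil

theorem HeadEquiv.symm {P Q : Proc Part Lab} (h : HeadEquiv P Q) : HeadEquiv Q P := by
  induction h with
  | recv p ℓ h => exact .recv p ℓ h.symm
  | send q ℓ e h => exact .send q ℓ e h.symm
  | add _ _ ihP ihQ => exact .add ihP ihQ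
  | cond e _ _ ihP ihQ => exact .cond e ihP ihQ
  | mu h => exact .mu h.symm
  | pvar n => exact .pvar n
  | nil => exact .nil

theorem HeadEquiv.trans {P Q R : Proc Part Lab} (h : HeadEquiv P Q) (h' : HeadEquiv Q R) :
    HeadEquiv P R := by
  induction h generalizing R with
  | recv p ℓ h => cases h' with | recv _ _ h' => exact .recv p ℓ (h.trans h')
  | send q ℓ e h => cases h' with | send _ _ _ h' => exact .send q ℓ e (h.trans h')
  | add _ _ ihP ihQ => cases h' with | add h₁ h₂ => exact .add (ihP h₁) (ihQ h₂)
  | cond e _ _ ihP ihQ => cases h' with | cond _ h₁ h₂ => exact .cond e (ihP h₁) (ihQ h₂)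
  | mu h => cases h' with | mu h' => exact .mu (h.trans h')
  | pvar n => exact h'
  | nil => exact h'

theorem HeadEquiv.subst {P Q : Proc Part Lab} (h : HeadEquiv P Q) {σ τ : ℕ → Proc Part Lab}
    (hE : ∀ n, Equi (σ n) (τ n)) (hH : ∀ n, HeadEquiv (σ n) (τ n)) :
    HeadEquiv (P.subst σ) (Q.subst τ) := by
  induction h with
  | recv p ℓ h => exact .recv p ℓ (h.subst_congr fun n => (hE n).renameE _)
  | send q ℓ e h => exact .send q ℓ e (h.subst_congr hE)
  | add _ _ ihP ihQ => exact .add ihP ihQ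
  | cond e _ _ ihP ihQ => exact .cond e ihP ihQ
  | mu h => exact .mu (h.subst_congr (equi_liftSubst hE))
  | pvar n => exact hH n
  | nil => exact .nil

/-- Identified guarded processes agree down to the first prefixes once exposed recursions are
unfolded. -/
theorem Equi.headEquiv_hnf {P Q : Proc Part Lab} (h : Equi P Q) (hP : P.Guarded) :
    HeadEquiv P.hnf Q.hnf := by
  induction h with
  | unfold P => rw [hnf_unfold hP.1]; exact .refl _
  | refl => exact .refl _
  | symm h ih => exact (ih (h.guarded_iff.2 hP)).symm
  | trans h _ ih₁ ih₂ => exact (ih₁ hP).trans (ih₂ (h.guarded_iff.1 hP))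
  | recv p ℓ h => exact .recv p ℓ h
  | send q ℓ e h => exact .send q ℓ e h
  | add _ _ ih₁ ih₂ => exact .add (ih₁ hP.1) (ih₂ hP.2)
  | cond e _ _ ih₁ ih₂ => exact .cond e (ih₁ hP.1) (ih₂ hP.2)
  | mu h ih =>
    refine (ih hP.2).subst (fun n => ?_) fun n => ?_
    · cases n with
      | zero => exact .mu h
      | succ n => exact .refl _
    · cases n with
      | zero => exact .mu h
      | succ n => exact .refl _

/-! ### Summands of external choices -/

theorem summands_renameE (f : ℕ → ℕ) (P : Proc Part Lab) :
    (P.renameE f).summands = P.summands.map (renameE f) := by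
  induction P generalizing f <;> simp_all [renameE, summands]

theorem summands_subst {σ : ℕ → Proc Part Lab} {P : Proc Part Lab}
    (h : ∀ Q ∈ P.summands, ∃ p ℓ R, Q = recv p ℓ R) :
    (P.subst σ).summands = P.summands.map (subst σ) := by
  induction P with
  | add P Q ihP ihQ =>
    simp only [summands, List.mem_append] at h
    simp only [subst, summands, List.map_append]
    rw [ihP fun R hR => h R (.inl hR), ihQ fun R hR => h R (.inr hR)]
  | pvar n => simp [summands] at h
  | _ => rfl

theorem hnf_eq_self_of_summands {P : Proc Part Lab}
    (h : ∀ Q ∈ P.summands, ∃ p ℓ R, Q = recv p ℓ R) : P.hnf = P := by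
  induction P with
  | add P Q ihP ihQ =>
    simp only [summands, List.mem_append] at h
    rw [hnf, ihP fun R hR => h R (.inl hR), ihQ fun R hR => h R (.inr hR)]
  | cond => simp [summands] at h
  | mu => simp [summands] at h
  | _ => rfl

theorem HeadEquiv.summands {P Q : Proc Part Lab} (h : HeadEquiv P Q) :
    List.Forall₂ HeadEquiv P.summands Q.summands := by
  induction h with
  | add _ _ ihP ihQ => exact List.rel_append ihP ihQ
  | recv p ℓ h => exact .cons (.recv p ℓ h) .nil
  | send q ℓ e h => exact .cons (.send q ℓ e h) .nil
  | cond e h₁ h₂ => exact .cons (.cond e h₁ h₂) .nil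
  | mu h => exact .cons (.mu h) .nil
  | pvar n => exact .cons (.pvar n) .nil
  | nil => exact .cons .nil .nil

theorem HeadEquiv.summands_eq_ofFn {P P' : Proc Part Lab} (h : HeadEquiv P P') {q : Part} {n : ℕ}
    {ℓ : Fin n → Lab} {Q : Fin n → Proc Part Lab}
    (hP : P.summands = List.ofFn fun i => Proc.recv q (ℓ i) (Q i)) :
    ∃ Q' : Fin n → Proc Part Lab, (P'.summands = List.ofFn fun i => Proc.recv q (ℓ i) (Q' i)) ∧
      ∀ i, Equi (Q i) (Q' i) := by
  have hs := h.summands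
  rw [hP, List.forall₂_iff_get] at hs
  obtain ⟨hlen, hs⟩ := hs
  rw [List.length_ofFn] at hlen
  have key : ∀ i : Fin n, ∃ R, P'.summands[(i : ℕ)]'(hlen ▸ i.2) = Proc.recv q (ℓ i) R ∧
      Equi (Q i) R := by
    intro i
    have := hs i (by simp) (hlen ▸ i.2)
    simp only [List.get_eq_getElem, List.getElem_ofFn, Fin.eta] at this
    generalize P'.summands[(i : ℕ)]'(hlen ▸ i.2) = X at this
    cases this with
    | recv _ _ h => exact ⟨_, rfl, h⟩
  choose Q' hQ' hE using key
  refine ⟨Q', List.ext_getElem (by simp [← hlen]) fun i h₁ h₂ => ?_, hE⟩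
  rw [List.getElem_ofFn]
  exact hQ' ⟨i, hlen ▸ h₁⟩

theorem exists_recv_of_summands_eq_ofFn {P : Proc Part Lab} {q : Part} {n : ℕ}
    {ℓ : Fin n → Lab} {Q : Fin n → Proc Part Lab}
    (hP : P.summands = List.ofFn fun i => Proc.recv q (ℓ i) (Q i)) :
    ∀ R ∈ P.summands, ∃ p ℓ R', R = recv p ℓ R' := by
  intro R hR
  rw [hP, List.mem_ofFn] at hR
  obtain ⟨i, rfl⟩ := hR
  exact ⟨_, _, _, rfl⟩

end Proc

/-! ### Sorts and expressions -/

theorem subsort_iff {S S' : Srt} : Subsort S S' ↔ S = S' ∨ (S = .nat ∧ S' = .int) := by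
  constructor
  · intro h
    induction h with
    | refl => exact .inl rfl
    | tail _ h ih => cases h; rcases ih with rfl | ⟨_, ⟨⟩⟩; exact .inr ⟨rfl, rfl⟩
  · rintro (rfl | ⟨rfl, rfl⟩)
    · exact .refl
    · exact .single .nat_int

theorem Subsort.trans {S₁ S₂ S₃ : Srt} (h : Subsort S₁ S₂) (h' : Subsort S₂ S₃) :
    Subsort S₁ S₃ :=
  Relation.ReflTransGen.trans h h'

theorem ExprTyped.rename {Γ Γ' : List Srt} {e : Expr} {S : Srt} (h : ExprTyped Γ e S)
    {f : ℕ → ℕ} (hf : ∀ n S, Γ[n]? = some S → Γ'[f n]? = some S) :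
    ExprTyped Γ' (e.rename f) S := by
  induction h with
  | nat n => exact .nat n
  | int z => exact .int z
  | bool b => exact .bool b
  | var h => exact .var (hf _ _ h)
  | succ _ ih => exact .succ ih
  | neg _ ih => exact .neg ih
  | not _ ih => exact .not ih
  | choice _ _ ih₁ ih₂ => exact .choice ih₁ ih₂
  | gt _ _ ih₁ ih₂ => exact .gt ih₁ ih₂
  | sub _ h ih => exact .sub ih h

/-- What a typing of an expression says about its immediate subexpressions, subsumption being
absorbed. -/
theorem ExprTyped.inversion {Γ : List Srt} {e : Expr} {S : Srt} (h : ExprTyped Γ e S) :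
    match e with
    | .var n => ∃ S₀, Γ[n]? = some S₀ ∧ Subsort S₀ S
    | .num z => S = .int ∨ (S = .nat ∧ 0 ≤ z)
    | .bool _ => S = .bool
    | .succ e => ExprTyped Γ e .nat
    | .neg e => ExprTyped Γ e .int
    | .not e => ExprTyped Γ e .bool
    | .choice _ _ => True
    | .gt e₁ _ => ExprTyped Γ e₁ .int := by
  induction h with
  | nat n => exact .inr ⟨rfl, by simp⟩
  | int z => exact .inl rfl
  | bool b => rfl
  | var h => exact ⟨_, h, .refl⟩
  | succ h _ => exact h
  | neg h _ => exact h
  | not h _ => exact h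
  | choice _ _ _ _ => trivial
  | gt h _ _ _ => exact h
  | @sub e S S' _ h ih =>
    cases e with
    | var n => obtain ⟨S₀, h₁, h₂⟩ := ih; exact ⟨S₀, h₁, h₂.trans h⟩
    | num z =>
      rw [subsort_iff] at h
      rcases h with rfl | ⟨rfl, rfl⟩
      · exact ih
      · exact .inl rfl
    | bool b =>
      rw [subsort_iff] at h
      rcases h with rfl | ⟨rfl, rfl⟩
      · exact ih
      · cases ih
    | _ => exact ih

theorem exprTyped_sortTest (S : Srt) (Γ : List Srt) :
    ExprTyped (S :: Γ) (sortTest S) .bool := by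
  cases S with
  | nat => exact .gt (.sub (.succ (.var rfl)) (.single .nat_int)) (.int 0)
  | int => exact .gt (.neg (.var rfl)) (.int 0)
  | bool => exact .not (.var rfl)

theorem exprTyped_sortValue (S : Srt) (Γ : List Srt) : ExprTyped Γ (sortValue S) S := by
  cases S with
  | nat => exact .nat 5
  | int => exact .int (-5)
  | bool => exact .bool true

/-- The test for the sort `S` accepts a variable only if its sort is below `S`. -/
theorem subsort_of_sortTest {S S' : Srt} {Γ : List Srt}
    (h : ExprTyped (S' :: Γ) (sortTest S) .bool) : Subsort S' S := by
  have key : ∀ {S}, ExprTyped (S' :: Γ) (.var 0) S → Subsort S' S := fun h => by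
    obtain ⟨S₀, h₁, h₂⟩ := h.inversion
    cases h₁
    exact h₂
  cases S with
  | nat => exact key h.inversion.inversion
  | int => exact key h.inversion.inversion
  | bool => exact key h.inversion

/-- The value for the sort `S` belongs only to the sorts above `S`. -/
theorem subsort_of_sortValue {S S' : Srt} {Γ : List Srt}
    (h : ExprTyped Γ (sortValue S) S') : Subsort S S' := by
  rw [subsort_iff]
  cases S with
  | nat => rcases h.inversion with rfl | ⟨rfl, _⟩ <;> simp
  | int => rcases h.inversion with rfl | ⟨rfl, h⟩ <;> simp_all
  | bool => exact .inl h.inversion.symm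

/-! ### Renaming and substitution in types -/

namespace Ty

variable {Part : Type u} {Lab : Type v}

theorem rename_rename (f g : ℕ → ℕ) (T : Ty Part Lab) :
    (T.rename f).rename g = T.rename (g ∘ f) := by
  induction T generalizing f g <;> simp_all [rename, liftRen_comp]

theorem rename_succ_comm (f : ℕ → ℕ) (T : Ty Part Lab) :
    (T.rename f).rename Nat.succ = (T.rename Nat.succ).rename (liftRen f) := by
  rw [rename_rename, rename_rename]; rfl

theorem liftSubst_comp_liftRen (f : ℕ → ℕ) (σ : ℕ → Ty Part Lab) :
    (fun n => liftSubst σ (liftRen f n)) = liftSubst fun n => σ (f n) := by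
  funext n; cases n <;> rfl

theorem rename_subst (f : ℕ → ℕ) (σ : ℕ → Ty Part Lab) (T : Ty Part Lab) :
    (T.rename f).subst σ = T.subst fun n => σ (f n) := by
  induction T generalizing f σ <;> simp_all [subst, rename, liftSubst_comp_liftRen]

theorem liftSubst_rename (f : ℕ → ℕ) (σ : ℕ → Ty Part Lab) :
    (fun n => (liftSubst σ n).rename (liftRen f)) = liftSubst fun n => (σ n).rename f := by
  funext n; cases n
  · rfl
  · simp [liftSubst, rename_succ_comm]

theorem subst_rename (f : ℕ → ℕ) (σ : ℕ → Ty Part Lab) (T : Ty Part Lab) :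
    (T.subst σ).rename f = T.subst fun n => (σ n).rename f := by
  induction T generalizing f σ <;> simp_all [subst, rename, liftSubst_rename]

theorem liftSubst_subst (σ τ : ℕ → Ty Part Lab) :
    (fun n => (liftSubst σ n).subst (liftSubst τ)) = liftSubst fun n => (σ n).subst τ := by
  funext n; cases n
  · rfl
  · simp [liftSubst, rename_subst, subst_rename]

theorem subst_subst (σ τ : ℕ → Ty Part Lab) (T : Ty Part Lab) :
    (T.subst σ).subst τ = T.subst fun n => (σ n).subst τ := by
  induction T generalizing σ τ <;> simp_all [subst, liftSubst_subst]

theorem liftSubst_tvar : liftSubst (tvar : ℕ → Ty Part Lab) = tvar := by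
  funext n; cases n <;> rfl

theorem subst_tvar (T : Ty Part Lab) : T.subst tvar = T := by
  induction T <;> simp_all [subst, liftSubst_tvar]

/-- A substitution that fixes every variable below `k` fixes the types closed at `k`. -/
theorem ClosedAt.subst_eq {T : Ty Part Lab} {k : ℕ} (h : T.ClosedAt k) {σ : ℕ → Ty Part Lab}
    (hσ : ∀ n < k, σ n = tvar n) : T.subst σ = T := by
  induction T generalizing k σ with
  | inter p n ℓ S T ih => simp only [subst]; congr; funext i; exact ih i (h i) hσ
  | union p n ℓ S T ih => simp only [subst]; congr; funext i; exact ih i (h i) hσ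
  | mu T ih =>
    simp only [subst]
    congr 1
    refine ih h fun n hn => ?_
    cases n with
    | zero => rfl
    | succ n => simp [liftSubst, hσ n (by omega), rename]
  | tvar n => exact hσ n h
  | done => rfl

/-! ### Session types under unfolding -/

theorem exposed_rename (n : ℕ) (T : Ty Part Lab) (f : ℕ → ℕ) :
    (T.rename f).Exposed n ↔ ∃ m, f m = n ∧ T.Exposed m := by
  induction T generalizing f n with
  | mu T ih =>
    simp only [rename, Exposed, ih]
    constructor
    · rintro ⟨m, hm, h⟩
      cases m with
      | zero => simp [liftRen] at hm
      | succ m => exact ⟨m, by simpa [liftRen] using hm, h⟩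
    · rintro ⟨m, rfl, h⟩
      exact ⟨m + 1, rfl, h⟩
  | _ => simp [rename, Exposed]

theorem Guarded.rename {T : Ty Part Lab} (h : T.Guarded) (f : ℕ → ℕ) : (T.rename f).Guarded := by
  induction T generalizing f with
  | inter p n ℓ S T ih => exact fun i => ih i (h i) f
  | union p n ℓ S T ih => exact fun i => ih i (h i) f
  | mu T ih =>
    refine ⟨?_, ih h.2 _⟩
    rw [exposed_rename]
    rintro ⟨m, hm, h'⟩
    cases m with
    | zero => exact h.1 h'
    | succ m => simp [liftRen] at hm
  | tvar n => trivial
  | done => trivial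

theorem DistinctLabels.rename {T : Ty Part Lab} (h : T.DistinctLabels) (f : ℕ → ℕ) :
    (T.rename f).DistinctLabels := by
  induction T generalizing f with
  | inter p n ℓ S T ih => exact ⟨h.1, fun i => ih i (h.2 i) f⟩
  | union p n ℓ S T ih => exact ⟨h.1, fun i => ih i (h.2 i) f⟩
  | mu T ih => exact ih h _
  | tvar n => trivial
  | done => trivial

theorem ClosedAt.rename {T : Ty Part Lab} {k m : ℕ} (h : T.ClosedAt k) {f : ℕ → ℕ}
    (hf : ∀ n < k, f n < m) : (T.rename f).ClosedAt m := by
  induction T generalizing k m f with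
  | inter p n ℓ S T ih => exact fun i => ih i (h i) hf
  | union p n ℓ S T ih => exact fun i => ih i (h i) hf
  | mu T ih =>
    refine ih (k := k + 1) h fun n hn => ?_
    cases n with
    | zero => simp [liftRen]
    | succ n => simpa [liftRen] using hf n (by omega)
  | tvar n => exact hf n h
  | done => trivial

theorem exposed_subst (σ : ℕ → Ty Part Lab) (n : ℕ) (T : Ty Part Lab) :
    (T.subst σ).Exposed n ↔ ∃ m, T.Exposed m ∧ (σ m).Exposed n := by
  induction T generalizing σ n with
  | mu T ih =>
    simp only [subst, Exposed, ih]
    constructor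
    · rintro ⟨m, hm, h⟩
      cases m with
      | zero => simp [liftSubst, Exposed] at h
      | succ m => exact ⟨m, hm, by simpa [liftSubst, exposed_rename] using h⟩
    · rintro ⟨m, hm, h⟩
      exact ⟨m + 1, hm, by simpa [liftSubst, exposed_rename] using h⟩
  | _ => simp [subst, Exposed]

theorem Guarded.subst {T : Ty Part Lab} (h : T.Guarded) {σ : ℕ → Ty Part Lab}
    (hσ : ∀ n, (σ n).Guarded) : (T.subst σ).Guarded := by
  induction T generalizing σ with
  | inter p n ℓ S T ih => exact fun i => ih i (h i) hσ
  | union p n ℓ S T ih => exact fun i => ih i (h i) hσ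
  | mu T ih =>
    refine ⟨?_, ih h.2 fun n => ?_⟩
    · rw [exposed_subst]
      rintro ⟨m, hm, h'⟩
      cases m with
      | zero => exact h.1 hm
      | succ m => simp [liftSubst, exposed_rename] at h'
    · cases n with
      | zero => trivial
      | succ n => exact (hσ n).rename _
  | tvar n => exact hσ n
  | done => trivial

theorem DistinctLabels.subst {T : Ty Part Lab} (h : T.DistinctLabels) {σ : ℕ → Ty Part Lab}
    (hσ : ∀ n, (σ n).DistinctLabels) : (T.subst σ).DistinctLabels := by
  induction T generalizing σ with
  | inter p n ℓ S T ih => exact ⟨h.1, fun i => ih i (h.2 i) hσ⟩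
  | union p n ℓ S T ih => exact ⟨h.1, fun i => ih i (h.2 i) hσ⟩
  | mu T ih =>
    refine ih h fun n => ?_
    cases n with
    | zero => trivial
    | succ n => exact (hσ n).rename _
  | tvar n => exact hσ n
  | done => trivial

theorem ClosedAt.subst {T : Ty Part Lab} {k m : ℕ} (h : T.ClosedAt k) {σ : ℕ → Ty Part Lab}
    (hσ : ∀ n < k, (σ n).ClosedAt m) : (T.subst σ).ClosedAt m := by
  induction T generalizing k m σ with
  | inter p n ℓ S T ih => exact fun i => ih i (h i) hσ
  | union p n ℓ S T ih => exact fun i => ih i (h i) hσ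
  | mu T ih =>
    refine ih (k := k + 1) h fun n hn => ?_
    cases n with
    | zero => exact Nat.succ_pos m
    | succ n => exact (hσ n (by omega)).rename fun i hi => by omega
  | tvar n => exact hσ n h
  | done => trivial

theorem IsSessionType.unfold {T : Ty Part Lab} (h : (mu T).IsSessionType) :
    T.unfold.IsSessionType where
  closed := ClosedAt.subst (k := 1) h.closed fun n hn => by
    cases n with
    | zero => exact h.closed
    | succ n => omega
  guarded := h.guarded.2.subst fun n => by
    cases n with
    | zero => exact h.guarded
    | succ n => trivial
  distinctLabels := DistinctLabels.subst (T := T) h.distinctLabels fun n => by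
    cases n with
    | zero => exact h.distinctLabels
    | succ n => trivial

theorem IsSessionType.unfolds {T H : Ty Part Lab} (hT : T.IsSessionType) (h : Unfolds T H) :
    H.IsSessionType := by
  induction h with
  | mu _ ih => exact ih hT.unfold
  | _ => exact hT

theorem IsSessionType.of_inter {p : Part} {n : ℕ} {ℓ : Fin (n + 1) → Lab}
    {S : Fin (n + 1) → Srt} {T : Fin (n + 1) → Ty Part Lab}
    (h : (inter p n ℓ S T).IsSessionType) (i : Fin (n + 1)) : (T i).IsSessionType :=
  ⟨h.closed i, h.guarded i, h.distinctLabels.2 i⟩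

theorem IsSessionType.of_union {p : Part} {n : ℕ} {ℓ : Fin (n + 1) → Lab}
    {S : Fin (n + 1) → Srt} {T : Fin (n + 1) → Ty Part Lab}
    (h : (union p n ℓ S T).IsSessionType) (i : Fin (n + 1)) : (T i).IsSessionType :=
  ⟨h.closed i, h.guarded i, h.distinctLabels.2 i⟩

/-- The number of leading recursions of a type. -/
def leadingMus : Ty Part Lab → ℕ
  | mu T => T.leadingMus + 1
  | _ => 0

theorem leadingMus_subst {T : Ty Part Lab} (h : T.Guarded) {σ : ℕ → Ty Part Lab}
    (hT : ∀ n, ¬ T.Exposed n) : (T.subst σ).leadingMus = T.leadingMus := by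
  induction T generalizing σ with
  | mu T ih =>
    simp only [subst, leadingMus]
    rw [ih h.2]
    intro n
    cases n with
    | zero => exact h.1
    | succ n => exact hT n
  | tvar n => exact absurd rfl (hT n)
  | _ => rfl

theorem ClosedAt.lt_of_exposed {T : Ty Part Lab} {k n : ℕ} (h : T.ClosedAt k)
    (hn : T.Exposed n) : n < k := by
  induction T generalizing k n with
  | mu T ih => exact Nat.lt_of_succ_lt_succ (ih (k := k + 1) h hn)
  | tvar m => cases hn; exact h
  | _ => exact hn.elim

/-- Guardedness makes each unfolding remove one leading recursion, so a session type has a root. -/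
theorem IsSessionType.exists_unfolds {T : Ty Part Lab} (hT : T.IsSessionType) :
    ∃ H, Unfolds T H := by
  induction hk : T.leadingMus generalizing T with
  | zero =>
    cases T with
    | inter p n ℓ S T => exact ⟨_, .inter p n ℓ S T⟩
    | union p n ℓ S T => exact ⟨_, .union p n ℓ S T⟩
    | mu T => simp [leadingMus] at hk
    | tvar n => exact absurd hT.closed (Nat.not_lt_zero n)
    | done => exact ⟨_, .done⟩
  | succ k ih =>
    cases T with
    | mu T =>
      obtain ⟨H, hH⟩ := ih hT.unfold (by
        rw [Ty.unfold, leadingMus_subst hT.guarded.2]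
        · simpa [leadingMus] using hk
        · intro n hn
          have := ClosedAt.lt_of_exposed (k := 1) hT.closed hn
          obtain rfl : n = 0 := by omega
          exact hT.guarded.1 hn)
      exact ⟨H, .mu hH⟩
    | _ => simp [leadingMus] at hk

theorem Unfolds.unique {T H H' : Ty Part Lab} (h : Unfolds T H) (h' : Unfolds T H') :
    H = H' := by
  induction h with
  | mu _ ih => cases h' with | mu h' => exact ih h'
  | _ => cases h'; rfl

theorem Unfolds.ne_mu {T H : Ty Part Lab} (h : Unfolds T H) (U : Ty Part Lab) : H ≠ Ty.mu U := by
  induction h with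
  | mu _ ih => exact ih
  | _ => simp

theorem Unfolds.ne_tvar {T H : Ty Part Lab} (h : Unfolds T H) (n : ℕ) : H ≠ Ty.tvar n := by
  induction h with
  | mu _ ih => exact ih
  | _ => simp

/-! ### Subtyping -/

theorem SubStep.mono {R R' : Ty Part Lab → Ty Part Lab → Prop} (hR : ∀ U U', R U U' → R' U U')
    {T T' : Ty Part Lab} (h : SubStep R T T') : SubStep R' T T' := by
  cases h with
  | done h h' => exact .done h h'
  | inter p h h' hs =>
    refine .inter p h h' fun i => ?_
    obtain ⟨j, h₁, h₂, h₃⟩ := hs i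
    exact ⟨j, h₁, h₂, hR _ _ h₃⟩
  | union p h h' hs =>
    refine .union p h h' fun i => ?_
    obtain ⟨j, h₁, h₂, h₃⟩ := hs i
    exact ⟨j, h₁, h₂, hR _ _ h₃⟩

theorem Subtype.step {T T' : Ty Part Lab} (h : T.Subtype T') : SubStep Subtype T T' := by
  obtain ⟨R, hR, h⟩ := h
  exact (hR _ _ h).mono fun U U' hU => ⟨R, hR, hU⟩

theorem SubStep.subtype {T T' : Ty Part Lab} (h : SubStep Subtype T T') : T.Subtype T' :=
  ⟨SubStep Subtype, fun _ _ hU => hU.mono fun _ _ => Subtype.step, h⟩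

/-- Types with the same root are subtypes of one another. -/
theorem subtype_of_unfolds {T T' H : Ty Part Lab} (hT : T.IsSessionType) (h : Unfolds T H)
    (h' : Unfolds T' H) : T.Subtype T' := by
  refine ⟨fun U U' => U.IsSessionType ∧ ∃ H, Unfolds U H ∧ Unfolds U' H, ?_, hT, H, h, h'⟩
  rintro U U' ⟨hU, H, h, h'⟩
  have hH := hU.unfolds h
  cases H with
  | inter p n ℓ S T =>
    refine .inter p h h' fun i => ⟨i, rfl, .refl, hH.of_inter i, ?_⟩
    obtain ⟨H, h⟩ := (hH.of_inter i).exists_unfolds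
    exact ⟨H, h, h⟩
  | union p n ℓ S T =>
    refine .union p h h' fun i => ⟨i, rfl, .refl, hH.of_union i, ?_⟩
    obtain ⟨H, h⟩ := (hH.of_union i).exists_unfolds
    exact ⟨H, h, h⟩
  | done => exact .done h h'
  | mu T => exact absurd rfl (h.ne_mu T)
  | tvar n => exact absurd rfl (h.ne_tvar n)

theorem Subtype.refl {T : Ty Part Lab} (hT : T.IsSessionType) : T.Subtype T := by
  obtain ⟨H, h⟩ := hT.exists_unfolds
  exact subtype_of_unfolds hT h h

theorem unfold_subtype_mu {T : Ty Part Lab} (hT : (mu T).IsSessionType) :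
    T.unfold.Subtype (mu T) := by
  obtain ⟨H, h⟩ := hT.unfold.exists_unfolds
  exact subtype_of_unfolds hT.unfold h (.mu h)

theorem IsJoin.symm {T₁ T₂ T : Ty Part Lab} (h : IsJoin T₁ T₂ T) : IsJoin T₂ T₁ T := by
  cases h with
  | idem => exact .idem _
  | union q ι hℓ hS hT =>
    refine .union q ((Equiv.sumComm _ _).trans ι) ?_ ?_ ?_ <;>
    · rintro (s | s) <;> simp [hℓ, hS, hT]

theorem IsJoin.left_subtype {T₁ T₂ T : Ty Part Lab} (h : IsJoin T₁ T₂ T)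
    (hs : T.IsSessionType) : T₁.Subtype T := by
  cases h with
  | idem => exact .refl hs
  | union q ι hℓ hS hT =>
    refine (SubStep.union q (.union ..) (.union ..) fun i => ⟨ι (.inl i), ?_, ?_, ?_⟩).subtype
    · simp [hℓ]
    · simp [hS]; exact .refl
    · have := Subtype.refl (hs.of_union (ι (.inl i)))
      simpa [hT] using this

end Ty

variable {Part : Type u} {Lab : Type v}

/-! ### Renaming and substitution in typing derivations -/

theorem getElem?_liftRen {α : Type*} {l l' : List α} {f : ℕ → ℕ}
    (hf : ∀ n a, l[n]? = some a → l'[f n]? = some a) (b : α) (n : ℕ) (a : α)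
    (h : (b :: l)[n]? = some a) : (b :: l')[liftRen f n]? = some a := by
  cases n with
  | zero => exact h
  | succ n => exact hf n a (by simpa using h)

theorem Typed.renameE {Γ : List Srt} {Δ : List (Ty Part Lab)} {P : Proc Part Lab}
    {T : Ty Part Lab} (h : Typed Γ Δ P T) {Γ' : List Srt} {f : ℕ → ℕ}
    (hf : ∀ n S, Γ[n]? = some S → Γ'[f n]? = some S) : Typed Γ' Δ (P.renameE f) T := by
  induction h generalizing Γ' f with
  | inChoice q hs hℓ _ ih =>
    refine .inChoice q ?_ hℓ fun i => ih i (getElem?_liftRen hf _)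
    rw [Proc.summands_renameE, hs, List.map_ofFn]
    rfl
  | nil => exact .nil
  | out q ℓ he _ ih => exact .out q ℓ (he.rename hf) (ih hf)
  | cond he _ _ hj hT ih₁ ih₂ => exact .cond (he.rename hf) (ih₁ hf) (ih₂ hf) hj hT
  | recur hT _ ih => exact .recur hT (ih hf)
  | pvar h => exact .pvar h
  | sub _ hs hT ih => exact .sub (ih hf) hs hT
  | equi _ hE ih => exact .equi (ih hf) (hE.renameE f)

theorem Typed.renameE_succ {Γ : List Srt} {Δ : List (Ty Part Lab)} {P : Proc Part Lab}
    {T : Ty Part Lab} (h : Typed Γ Δ P T) (S : Srt) :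
    Typed (S :: Γ) Δ (P.renameE Nat.succ) T :=
  h.renameE fun _ _ hn => by simpa using hn

theorem summands_subst_ofFn {P : Proc Part Lab} {q : Part} {n : ℕ} {ℓ : Fin n → Lab}
    {Q : Fin n → Proc Part Lab} (hP : P.summands = List.ofFn fun i => Proc.recv q (ℓ i) (Q i))
    (σ : ℕ → Proc Part Lab) :
    (P.subst σ).summands = List.ofFn fun i =>
      Proc.recv q (ℓ i) ((Q i).subst fun n => (σ n).renameE Nat.succ) := by
  rw [Proc.summands_subst (Proc.exists_recv_of_summands_eq_ofFn hP), hP, List.map_ofFn]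
  rfl

theorem Typed.renameP {Γ : List Srt} {Δ : List (Ty Part Lab)} {P : Proc Part Lab}
    {T : Ty Part Lab} (h : Typed Γ Δ P T) {Δ' : List (Ty Part Lab)} {f : ℕ → ℕ}
    (hf : ∀ n U, Δ[n]? = some U → Δ'[f n]? = some U) : Typed Γ Δ' (P.renameP f) T := by
  induction h generalizing Δ' f with
  | inChoice q hs hℓ _ ih =>
    refine .inChoice q ?_ hℓ fun i => ih i hf
    simp only [Proc.renameP_eq_subst, summands_subst_ofFn hs, Proc.renameE]
  | nil => exact .nil
  | out q ℓ he _ ih => exact .out q ℓ he (ih hf)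
  | cond he _ _ hj hT ih₁ ih₂ => exact .cond he (ih₁ hf) (ih₂ hf) hj hT
  | recur hT _ ih => exact .recur hT (ih (getElem?_liftRen hf _))
  | pvar h => exact .pvar (hf _ _ h)
  | sub _ hs hT ih => exact .sub (ih hf) hs hT
  | equi _ hE ih => exact .equi (ih hf) (hE.renameP f)

theorem Typed.subst {Γ : List Srt} {Δ : List (Ty Part Lab)} {P : Proc Part Lab}
    {T : Ty Part Lab} (h : Typed Γ Δ P T) {Δ' : List (Ty Part Lab)} {σ : ℕ → Proc Part Lab}
    (hσ : ∀ n U, Δ[n]? = some U → Typed Γ Δ' (σ n) U) : Typed Γ Δ' (P.subst σ) T := by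
  induction h generalizing Δ' σ with
  | inChoice q hs hℓ _ ih =>
    exact .inChoice q (summands_subst_ofFn hs σ) hℓ fun i =>
      ih i fun n U hn => (hσ n U hn).renameE_succ _
  | nil => exact .nil
  | out q ℓ he _ ih => exact .out q ℓ he (ih hσ)
  | cond he _ _ hj hT ih₁ ih₂ => exact .cond he (ih₁ hσ) (ih₂ hσ) hj hT
  | recur hT _ ih =>
    refine .recur hT (ih fun n U hn => ?_)
    cases n with
    | zero => exact .pvar hn
    | succ n => exact (hσ n U (by simpa using hn)).renameP fun m V hm => by simpa using hm
  | pvar h => exact hσ _ _ h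
  | sub _ hs hT ih => exact .sub (ih hσ) hs hT
  | equi _ hE ih => exact .equi (ih hσ) (hE.subst σ)

/-! ### Typing of head normal forms -/

/-- Typing of a head normal form: above the first prefixes only the rules directed by the syntax
and subsumption are used, while the continuations are typed by `Typed`. -/
inductive HeadTyped (Γ : List Srt) (Δ : List (Ty Part Lab)) : Proc Part Lab → Ty Part Lab → Prop
  | inChoice {P : Proc Part Lab} (q : Part) {n : ℕ}
      {ℓ : Fin (n + 1) → Lab} {S : Fin (n + 1) → Srt} {T : Fin (n + 1) → Ty Part Lab}
      {Q : Fin (n + 1) → Proc Part Lab} :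
      P.summands = List.ofFn (fun i => Proc.recv q (ℓ i) (Q i)) →
      (∀ i, Typed (S i :: Γ) Δ (Q i) (T i)) → HeadTyped Γ Δ P (.inter q n ℓ S T)
  | nil : HeadTyped Γ Δ .nil .done
  | out (q : Part) (ℓ : Lab) {e : Expr} {S : Srt} {P : Proc Part Lab} {T : Ty Part Lab} :
      ExprTyped Γ e S → Typed Γ Δ P T →
      HeadTyped Γ Δ (.send q ℓ e P) (.union q 0 (fun _ => ℓ) (fun _ => S) (fun _ => T))
  | cond {e : Expr} {P₁ P₂ : Proc Part Lab} {T₁ T₂ T : Ty Part Lab} :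
      ExprTyped Γ e .bool → HeadTyped Γ Δ P₁ T₁ → HeadTyped Γ Δ P₂ T₂ →
      Ty.IsJoin T₁ T₂ T → T.IsSessionType → HeadTyped Γ Δ (.cond e P₁ P₂) T
  | pvar {n : ℕ} {T : Ty Part Lab} : Δ[n]? = some T → HeadTyped Γ Δ (.pvar n) T
  | sub {P : Proc Part Lab} {T T' : Ty Part Lab} :
      HeadTyped Γ Δ P T → T.Subtype T' → T'.IsSessionType → HeadTyped Γ Δ P T'

/-- Exposed variables need head-typed substitutes; below prefixes, `Typed` is enough. -/
theorem HeadTyped.subst {Γ : List Srt} {Δ : List (Ty Part Lab)} {P : Proc Part Lab}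
    {T : Ty Part Lab} (h : HeadTyped Γ Δ P T) {Δ' : List (Ty Part Lab)} {σ : ℕ → Proc Part Lab}
    (hσ : ∀ n U, Δ[n]? = some U → Typed Γ Δ' (σ n) U)
    (hH : ∀ n U, P.Exposed n → Δ[n]? = some U → HeadTyped Γ Δ' (σ n) U) :
    HeadTyped Γ Δ' (P.subst σ) T := by
  induction h with
  | inChoice q hs hQ =>
    exact .inChoice q (summands_subst_ofFn hs σ) fun i =>
      (hQ i).subst fun n U hn => (hσ n U hn).renameE_succ _
  | nil => exact .nil
  | out q ℓ he hP => exact .out q ℓ he (hP.subst hσ)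
  | cond he _ _ hj hT ih₁ ih₂ =>
    exact .cond he (ih₁ fun n U hn => hH n U (.inl hn)) (ih₂ fun n U hn => hH n U (.inr hn)) hj hT
  | pvar h => exact hH _ _ rfl h
  | sub _ hs hT ih => exact .sub (ih hH) hs hT

theorem HeadTyped.headEquiv {Γ : List Srt} {Δ : List (Ty Part Lab)} {P P' : Proc Part Lab}
    {T : Ty Part Lab} (h : HeadTyped Γ Δ P T) (hP : P.HeadEquiv P') : HeadTyped Γ Δ P' T := by
  induction h generalizing P' with
  | inChoice q hs hQ =>
    obtain ⟨Q', hs', hE⟩ := hP.summands_eq_ofFn hs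
    exact .inChoice q hs' fun i => (hQ i).equi (hE i)
  | nil => cases hP; exact .nil
  | out q ℓ he h => cases hP with | send _ _ _ hE => exact .out q ℓ he (h.equi hE)
  | cond he _ _ hj hT ih₁ ih₂ =>
    cases hP with | cond _ h₁ h₂ => exact .cond he (ih₁ h₁) (ih₂ h₂) hj hT
  | pvar h => cases hP; exact .pvar h
  | sub _ hs hT ih => exact .sub (ih hP) hs hT

/-- Every typing of a guarded process comes from a syntax-directed typing of its head normal
form: the recursion rule is absorbed by the substitution lemma, the identification of processes by
the fact that it relates head normal forms of the same shape. -/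
theorem Typed.headTyped_hnf {Γ : List Srt} {Δ : List (Ty Part Lab)} {P : Proc Part Lab}
    {T : Ty Part Lab} (h : Typed Γ Δ P T) (hP : P.Guarded) : HeadTyped Γ Δ P.hnf T := by
  induction h with
  | inChoice q hs _ hQ _ =>
    rw [Proc.hnf_eq_self_of_summands (Proc.exists_recv_of_summands_eq_ofFn hs)]
    exact .inChoice q hs hQ
  | nil => exact .nil
  | out q ℓ he h _ => exact .out q ℓ he h
  | cond he _ _ hj hT ih₁ ih₂ => exact .cond he (ih₁ hP.1) (ih₂ hP.2) hj hT
  | recur hT h ih =>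
    refine (ih hP.2).subst (fun n U hn => ?_) fun n U hx hn => ?_
    · cases n with
      | zero => cases hn; exact .recur hT h
      | succ n => exact .pvar (by simpa using hn)
    · cases n with
      -- By guardedness, the recursive process is substituted below prefixes only.
      | zero => exact absurd (Proc.exposed_of_hnf hx) hP.1
      | succ n => exact .pvar (by simpa using hn)
  | pvar h => exact .pvar h
  | sub _ hs hT ih => exact .sub (ih hP) hs hT
  | equi _ hE ih =>
    have hP' := hE.guarded_iff.2 hP
    exact (ih hP').headEquiv (hE.headEquiv_hnf hP')

/-! ### Inversion -/

theorem HeadTyped.cond_inversion {Γ : List Srt} {Δ : List (Ty Part Lab)} {e : Expr}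
    {P Q : Proc Part Lab} {T : Ty Part Lab} (h : HeadTyped Γ Δ (.cond e P Q) T) :
    ExprTyped Γ e .bool ∧ HeadTyped Γ Δ P T ∧ HeadTyped Γ Δ Q T := by
  generalize hR : Proc.cond e P Q = R at h
  induction h with
  | inChoice q hs hQ =>
    subst hR
    simp [Proc.summands] at hs
  | cond he h₁ h₂ hj hT =>
    cases hR
    exact ⟨he, h₁.sub (hj.left_subtype hT) hT, h₂.sub (hj.symm.left_subtype hT) hT⟩
  | sub _ hs hT ih =>
    obtain ⟨he, h₁, h₂⟩ := ih hR
    exact ⟨he, h₁.sub hs hT, h₂.sub hs hT⟩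
  | _ => cases hR

theorem HeadTyped.nil_inversion {Γ : List Srt} {Δ : List (Ty Part Lab)} {T : Ty Part Lab}
    (h : HeadTyped Γ Δ .nil T) : T.Unfolds .done := by
  generalize hR : Proc.nil = R at h
  induction h with
  | inChoice q hs hQ =>
    subst hR
    simp [Proc.summands] at hs
  | nil => exact .done
  | sub _ hs hT ih =>
    cases hs.step with
    | done _ h => exact h
    | inter _ h => cases (ih hR).unique h
    | union _ h => cases (ih hR).unique h
  | _ => cases hR

theorem HeadTyped.send_inversion {Γ : List Srt} {Δ : List (Ty Part Lab)} {q : Part} {ℓ : Lab}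
    {e : Expr} {P : Proc Part Lab} {T : Ty Part Lab} (h : HeadTyped Γ Δ (.send q ℓ e P) T) :
    ∃ (n : ℕ) (ℓ' : Fin (n + 1) → Lab) (S : Fin (n + 1) → Srt) (U : Fin (n + 1) → Ty Part Lab),
      T.Unfolds (.union q n ℓ' S U) ∧
        ∃ i, ℓ = ℓ' i ∧ ExprTyped Γ e (S i) ∧ Typed Γ Δ P (U i) := by
  generalize hR : Proc.send q ℓ e P = R at h
  induction h with
  | inChoice q hs hQ =>
    subst hR
    simp [Proc.summands] at hs
  | out q ℓ he h =>
    cases hR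
    exact ⟨0, _, _, _, .union .., 0, rfl, he, h⟩
  | sub _ hs hT ih =>
    obtain ⟨n, ℓ', S, U, hU, i, hℓ, he, hP⟩ := ih hR
    cases hs.step with
    | done h => cases hU.unique h
    | inter _ h => cases hU.unique h
    | union _ h h' hs =>
      cases hU.unique h
      obtain ⟨j, h₁, h₂, h₃⟩ := hs i
      exact ⟨_, _, _, _, h', j, hℓ.trans h₁, he.sub h₂, hP.sub h₃ ((hT.unfolds h').of_union j)⟩
  | _ => cases hR

theorem HeadTyped.recv_inversion {Γ : List Srt} {Δ : List (Ty Part Lab)} {q : Part} {n : ℕ}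
    {ℓ : Fin (n + 1) → Lab} {Q : Fin (n + 1) → Proc Part Lab} {P : Proc Part Lab}
    {T : Ty Part Lab} (h : HeadTyped Γ Δ P T)
    (hP : P.summands = List.ofFn fun i => Proc.recv q (ℓ i) (Q i)) :
    ∃ (n' : ℕ) (ℓ' : Fin (n' + 1) → Lab) (S : Fin (n' + 1) → Srt)
      (U : Fin (n' + 1) → Ty Part Lab), T.Unfolds (.inter q n' ℓ' S U) ∧
        ∀ i, ∃ j, ℓ j = ℓ' i ∧ ∃ S', Subsort (S i) S' ∧ Typed (S' :: Γ) Δ (Q j) (U i) := by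
  have hr := Proc.exists_recv_of_summands_eq_ofFn hP
  induction h with
  | @inChoice P q' n' ℓ' S U Q' hs hQ =>
    have hs' := hP.symm.trans hs
    obtain rfl : n = n' := by simpa using congrArg List.length hs'
    have h := List.ofFn_injective hs'
    have h0 := fun i => congrFun h i
    simp only [Proc.recv.injEq] at h0
    obtain rfl := (h0 0).1
    refine ⟨_, _, _, _, .inter .., fun i => ⟨i, (h0 i).2.1, _, .refl, ?_⟩⟩
    rw [(h0 i).2.2]
    exact hQ i
  | sub _ hs hT ih =>
    obtain ⟨n', ℓ', S, U, hU, hi⟩ := ih hP hr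
    cases hs.step with
    | done h => cases hU.unique h
    | union _ h => cases hU.unique h
    | inter _ h h' hs =>
      cases hU.unique h
      refine ⟨_, _, _, _, h', fun i => ?_⟩
      obtain ⟨k, h₁, h₂, h₃⟩ := hs i
      obtain ⟨j, h₄, S', h₅, h₆⟩ := hi k
      exact ⟨j, h₄.trans h₁, S', h₂.trans h₅, h₆.sub h₃ ((hT.unfolds h').of_inter i)⟩
  | _ => simp [Proc.summands] at hr

/-! ### Sums and internal choices -/

namespace Proc

theorem sum_renameE (f : ℕ → ℕ) {n : ℕ} (P : Fin (n + 1) → Proc Part Lab) :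
    (sum n P).renameE f = sum n fun i => (P i).renameE f := by
  induction n with
  | zero => rfl
  | succ n ih => simp [sum, renameE, ih]

theorem sum_renameP (f : ℕ → ℕ) {n : ℕ} (P : Fin (n + 1) → Proc Part Lab) :
    (sum n P).renameP f = sum n fun i => (P i).renameP f := by
  induction n with
  | zero => rfl
  | succ n ih => simp [sum, renameP, ih]

theorem sum_subst (σ : ℕ → Proc Part Lab) {n : ℕ} (P : Fin (n + 1) → Proc Part Lab) :
    (sum n P).subst σ = sum n fun i => (P i).subst σ := by
  induction n with
  | zero => rfl
  | succ n ih => simp [sum, subst, ih]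

theorem exposed_sum (m : ℕ) {n : ℕ} (P : Fin (n + 1) → Proc Part Lab) :
    (sum n P).Exposed m ↔ ∃ i, (P i).Exposed m := by
  induction n with
  | zero => simp [sum]
  | succ n ih => simp [sum, Exposed, ih, Fin.exists_fin_succ (n := n + 1)]

theorem guarded_sum {n : ℕ} (P : Fin (n + 1) → Proc Part Lab) :
    (sum n P).Guarded ↔ ∀ i, (P i).Guarded := by
  induction n with
  | zero => simp [sum]
  | succ n ih => simp [sum, Guarded, ih, Fin.forall_fin_succ (n := n + 1)]

theorem summands_sum_recv (q : Part) {n : ℕ} (ℓ : Fin (n + 1) → Lab)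
    (P : Fin (n + 1) → Proc Part Lab) :
    (sum n fun i => recv q (ℓ i) (P i)).summands = List.ofFn fun i => recv q (ℓ i) (P i) := by
  induction n with
  | zero => rfl
  | succ n ih =>
    simp only [sum, summands, ih]
    exact (List.ofFn_succ (f := fun i => recv q (ℓ i) (P i))).symm

theorem internal_renameE (f : ℕ → ℕ) {n : ℕ} (P : Fin (n + 1) → Proc Part Lab) :
    (internal n P).renameE f = internal n fun i => (P i).renameE f := by
  induction n with
  | zero => rfl
  | succ n ih => simp [internal, renameE, Expr.rename, ih]

theorem internal_renameP (f : ℕ → ℕ) {n : ℕ} (P : Fin (n + 1) → Proc Part Lab) :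
    (internal n P).renameP f = internal n fun i => (P i).renameP f := by
  induction n with
  | zero => rfl
  | succ n ih => simp [internal, renameP, ih]

theorem internal_subst (σ : ℕ → Proc Part Lab) {n : ℕ} (P : Fin (n + 1) → Proc Part Lab) :
    (internal n P).subst σ = internal n fun i => (P i).subst σ := by
  induction n with
  | zero => rfl
  | succ n ih => simp [internal, subst, ih]

theorem exposed_internal (m : ℕ) {n : ℕ} (P : Fin (n + 1) → Proc Part Lab) :
    (internal n P).Exposed m ↔ ∃ i, (P i).Exposed m := by
  induction n with
  | zero => simp [internal]
  | succ n ih => simp [internal, Exposed, ih, Fin.exists_fin_succ (n := n + 1)]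

theorem guarded_internal {n : ℕ} (P : Fin (n + 1) → Proc Part Lab) :
    (internal n P).Guarded ↔ ∀ i, (P i).Guarded := by
  induction n with
  | zero => simp [internal]
  | succ n ih => simp [internal, Guarded, ih, Fin.forall_fin_succ (n := n + 1)]

theorem hnf_internal {n : ℕ} (P : Fin (n + 1) → Proc Part Lab) :
    (internal n P).hnf = internal n fun i => (P i).hnf := by
  induction n with
  | zero => rfl
  | succ n ih => simp [internal, hnf, ih]

end Proc

/-- A type of an internal choice is a type of each alternative, since each side of a join is below
the join. -/
theorem HeadTyped.internal_inversion {Γ : List Srt} {Δ : List (Ty Part Lab)} {n : ℕ}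
    {P : Fin (n + 1) → Proc Part Lab} {T : Ty Part Lab}
    (h : HeadTyped Γ Δ (Proc.internal n P) T) (i : Fin (n + 1)) : HeadTyped Γ Δ (P i) T := by
  induction n with
  | zero => rwa [Fin.fin_one_eq_zero i]
  | succ n ih =>
    obtain ⟨-, h₁, h₂⟩ := h.cond_inversion
    cases i using Fin.cases with
    | zero => exact h₁
    | succ i => exact ih h₂ i

theorem Typed.internal {Γ : List Srt} {Δ : List (Ty Part Lab)} (q : Part) {n : ℕ}
    {P : Fin (n + 1) → Proc Part Lab} {ℓ : Fin (n + 1) → Lab} {S : Fin (n + 1) → Srt}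
    {T : Fin (n + 1) → Ty Part Lab}
    (hP : ∀ i, Typed Γ Δ (P i) (.union q 0 (fun _ => ℓ i) (fun _ => S i) fun _ => T i))
    (hT : (Ty.union q n ℓ S T).IsSessionType) :
    Typed Γ Δ (Proc.internal n P) (.union q n ℓ S T) := by
  induction n with
  | zero =>
    have hℓ : (fun _ => ℓ 0) = ℓ := by funext i; rw [Fin.fin_one_eq_zero i]
    have hS : (fun _ => S 0) = S := by funext i; rw [Fin.fin_one_eq_zero i]
    have hT₀ : (fun _ => T 0) = T := by funext i; rw [Fin.fin_one_eq_zero i]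
    have := hP 0
    rwa [hℓ, hS, hT₀] at this
  | succ n ih =>
    -- The union splits into its first branch and the union of the others.
    have hT' : (Ty.union q n (fun i => ℓ i.succ) (fun i => S i.succ)
        fun i => T i.succ).IsSessionType :=
      ⟨fun i => hT.closed i.succ, fun i => hT.guarded i.succ,
        hT.distinctLabels.1.comp (Fin.succ_injective _), fun i => hT.distinctLabels.2 i.succ⟩
    let ι : Fin (0 + 1) ⊕ Fin (n + 1) ≃ Fin (n + 1 + 1) :=
      { toFun := Sum.elim (fun _ => 0) Fin.succ
        invFun := Fin.cases (.inl 0) .inr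
        left_inv := by
          rintro (i | i)
          · rw [Fin.fin_one_eq_zero i]; rfl
          · rfl
        right_inv := fun i => by cases i using Fin.cases <;> rfl }
    refine .cond (.choice (.bool _) (.bool _)) (hP 0) (ih (fun i => hP i.succ) hT')
      (.union q ι ?_ ?_ ?_) hT <;>
    · rintro (i | i) <;> rfl

/-! ### Characteristic processes -/

theorem rename_sortTest (f : ℕ → ℕ) (S : Srt) : (sortTest S).rename (liftRen f) = sortTest S := by
  cases S <;> rfl

theorem rename_sortValue (f : ℕ → ℕ) (S : Srt) : (sortValue S).rename f = sortValue S := by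
  cases S <;> rfl

/-- Characteristic processes have no free expression variables, so substitution under an input
does not shift them. -/
theorem charProc_renameE (f : ℕ → ℕ) (T : Ty Part Lab) :
    (charProc T).renameE f = charProc T := by
  induction T generalizing f with
  | inter p n ℓ S T ih =>
    simp [charProc, Proc.sum_renameE, Proc.renameE, rename_sortTest, ih]
  | union p n ℓ S T ih =>
    simp [charProc, Proc.internal_renameE, Proc.renameE, rename_sortValue, ih]
  | _ => simp_all [charProc, Proc.renameE]

theorem charProc_rename (f : ℕ → ℕ) (T : Ty Part Lab) :
    charProc (T.rename f) = (charProc T).renameP f := by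
  induction T generalizing f with
  | inter p n ℓ S T ih => simp [charProc, Ty.rename, Proc.sum_renameP, Proc.renameP, ih]
  | union p n ℓ S T ih => simp [charProc, Ty.rename, Proc.internal_renameP, Proc.renameP, ih]
  | _ => simp_all [charProc, Ty.rename, Proc.renameP]

theorem charProc_subst (σ : ℕ → Ty Part Lab) (T : Ty Part Lab) :
    charProc (T.subst σ) = (charProc T).subst fun n => charProc (σ n) := by
  induction T generalizing σ with
  | inter p n ℓ S T ih =>
    simp [charProc, Ty.subst, Proc.sum_subst, Proc.subst, charProc_renameE, ih]
  | union p n ℓ S T ih => simp [charProc, Ty.subst, Proc.internal_subst, Proc.subst, ih]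
  | mu T ih =>
    have h : (fun n => charProc (Ty.liftSubst σ n)) =
        Proc.liftSubst fun n => charProc (σ n) := by
      funext n
      cases n with
      | zero => rfl
      | succ n => exact charProc_rename _ _
    simp [charProc, Ty.subst, Proc.subst, ih, h]
  | _ => rfl

theorem charProc_unfold (T : Ty Part Lab) : charProc T.unfold = (charProc T).unfold := by
  rw [Ty.unfold, charProc_subst, Proc.unfold]
  congr 1
  funext n
  cases n <;> rfl

theorem exposed_charProc (n : ℕ) (T : Ty Part Lab) : (charProc T).Exposed n ↔ T.Exposed n := by
  induction T generalizing n with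
  | inter p m ℓ S T ih => simp [charProc, Proc.exposed_sum, Proc.Exposed, Ty.Exposed]
  | union p m ℓ S T ih => simp [charProc, Proc.exposed_internal, Proc.Exposed, Ty.Exposed]
  | mu T ih => exact ih (n + 1)
  | _ => exact Iff.rfl

theorem guarded_charProc {T : Ty Part Lab} (h : T.Guarded) : (charProc T).Guarded := by
  induction T with
  | inter p n ℓ S T ih => exact (Proc.guarded_sum _).2 fun i => ⟨ih i (h i), ih i (h i)⟩
  | union p n ℓ S T ih => exact (Proc.guarded_internal _).2 fun i => ih i (h i)
  | mu T ih => exact ⟨(exposed_charProc 0 T).not.2 h.1, ih h.2⟩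
  | _ => trivial

theorem hnf_charProc_of_unfolds {T H : Ty Part Lab} (hT : T.IsSessionType) (h : T.Unfolds H) :
    (charProc T).hnf = (charProc H).hnf := by
  induction h with
  | @mu T H _ ih =>
    rw [← ih hT.unfold, charProc_unfold, Proc.hnf_unfold]
    · rfl
    · exact (exposed_charProc 0 T).not.2 hT.guarded.1
  | _ => rfl

theorem Ty.subst_liftSubst_instSubst (σ : ℕ → Ty Part Lab) (T U : Ty Part Lab) :
    (T.subst (liftSubst σ)).subst (instSubst U) =
      T.subst fun n => Nat.casesOn n U σ := by
  rw [subst_subst]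
  congr 1
  funext n
  cases n with
  | zero => rfl
  | succ n =>
    simp only [liftSubst, rename_subst, instSubst]
    exact subst_tvar _

/-- The characteristic process of a type has that type. For an open type, the process variables
have the types that are substituted for the type variables. -/
theorem charProc_typed {T : Ty Part Lab} (Γ : List Srt) {Δ : List (Ty Part Lab)}
    (hΔ : ∀ n, (Δ.getD n .done).IsSessionType) (hc : T.ClosedAt Δ.length) (hg : T.Guarded)
    (hd : T.DistinctLabels) : Typed Γ Δ (charProc T) (T.subst fun n => Δ.getD n .done) := by
  have hs : (T.subst fun n => Δ.getD n .done).IsSessionType :=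
    ⟨hc.subst fun n _ => (hΔ n).closed, hg.subst fun n => (hΔ n).guarded,
      hd.subst fun n => (hΔ n).distinctLabels⟩
  induction T generalizing Γ Δ with
  | inter p n ℓ S T ih =>
    refine .inChoice p (Proc.summands_sum_recv ..) hd.1 fun i => ?_
    have hs' := hs.of_inter i
    have h := ih i (S i :: Γ) hΔ (hc i) (hg i) (hd.2 i) hs'
    exact .cond (exprTyped_sortTest _ _) h h (.idem _) hs'
  | union p n ℓ S T ih =>
    exact .internal p (fun i => .out p (ℓ i) (exprTyped_sortValue _ _)
      (ih i Γ hΔ (hc i) (hg i) (hd.2 i) (hs.of_union i))) hs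
  | mu T ih =>
    set σ : ℕ → Ty Part Lab := fun n => Δ.getD n .done with hσ
    have hU : (T.subst fun n => ((Ty.mu T).subst σ :: Δ).getD n .done) =
        (T.subst (Ty.liftSubst σ)).unfold := by
      refine Eq.trans ?_ (Ty.subst_liftSubst_instSubst σ T _).symm
      congr 1
      funext n
      cases n <;> rfl
    -- The body is typed with the closed recursive type for its variable, and so gets the unfolding.
    have h := ih Γ (Δ := (Ty.mu T).subst σ :: Δ)
      (fun n => by cases n with | zero => exact hs | succ n => exact hΔ n) hc hg.2 hd
    rw [hU] at h
    exact .recur hs ((h hs.unfold).sub (Ty.unfold_subtype_mu hs) hs)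
  | tvar n =>
    refine .pvar ?_
    have hn : n < Δ.length := hc
    simp [Ty.subst, hn]
  | done => exact .nil

theorem charProc_mem_denotation {T : Ty Part Lab} (hT : T.IsSessionType) :
    charProc T ∈ denotation T := by
  refine ⟨guarded_charProc hT.guarded, ?_⟩
  have h := charProc_typed (T := T) [] (Δ := [])
    (fun n => ⟨trivial, trivial, trivial⟩) hT.closed hT.guarded hT.distinctLabels
  rwa [hT.closed.subst_eq fun n hn => absurd hn (Nat.not_lt_zero n)] at h

/-- If the head normal form of the characteristic process of `T` has type `T'`, then `T ≤ T'`: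
the relation that pairs a type with the types of the head normal form of its characteristic
process is closed backward under the subtyping rules. -/
theorem subtype_of_headTyped_charProc {T T' : Ty Part Lab} (hT : T.IsSessionType)
    (hT' : T'.IsSessionType) (h : HeadTyped [] [] (charProc T).hnf T') : T.Subtype T' := by
  refine ⟨fun U U' => U.IsSessionType ∧ U'.IsSessionType ∧
    ∃ Γ, HeadTyped Γ [] (charProc U).hnf U', ?_, hT, hT', [], h⟩
  rintro U U' ⟨hU, hU', Γ, h⟩
  obtain ⟨H, hH⟩ := hU.exists_unfolds
  have hs := hU.unfolds hH
  rw [hnf_charProc_of_unfolds hU hH] at h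
  cases H with
  | inter p n ℓ S V =>
    have hsum := Proc.summands_sum_recv p ℓ fun i =>
      .cond (sortTest (S i)) (charProc (V i)) (charProc (V i))
    rw [charProc,
      Proc.hnf_eq_self_of_summands (Proc.exists_recv_of_summands_eq_ofFn hsum)] at h
    obtain ⟨n', ℓ', S', V', hV, hi⟩ := h.recv_inversion hsum
    refine .inter p hH hV fun i => ?_
    -- The conditional on the sort test, below the input, bounds the sort of the received value.
    obtain ⟨j, hℓ, S'', hS, hP⟩ := hi i
    have hg := guarded_charProc (hs.of_inter j).guarded
    obtain ⟨he, hP, -⟩ := (hP.headTyped_hnf ⟨hg, hg⟩).cond_inversion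
    exact ⟨j, hℓ, hS.trans (subsort_of_sortTest he), hs.of_inter j, (hU'.unfolds hV).of_inter i,
      _, hP⟩
  | union p n ℓ S V =>
    rw [charProc, Proc.hnf_internal] at h
    have hi := fun i => (h.internal_inversion i).send_inversion
    obtain ⟨n', ℓ', S', V', hV, -⟩ := hi 0
    refine .union p hH hV fun i => ?_
    obtain ⟨m, ℓ'', S'', V'', hV', j, hℓ, he, hP⟩ := hi i
    cases hV.unique hV'
    exact ⟨j, hℓ, subsort_of_sortValue he, hs.of_union i, (hU'.unfolds hV).of_union j, _,
      hP.headTyped_hnf (guarded_charProc (hs.of_union i).guarded)⟩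
  | done => exact .done hH h.nil_inversion
  | mu V => exact absurd rfl (hH.ne_mu V)
  | tvar n => exact absurd rfl (hH.ne_tvar n)

end MPST

theorem mainTheorem2 {Part : Type*} {Lab : Type*} (T T' : MPST.Ty Part Lab)
    (hT : T.IsSessionType) (hT' : T'.IsSessionType) :
    (T.Subtype T' ↔ MPST.denotation T ⊆ MPST.denotation T') ∧
      (MPST.Typed [] [] (MPST.charProc T) T' → T.Subtype T') := by
  have key : MPST.Typed [] [] (MPST.charProc T) T' → T.Subtype T' := fun h =>
    MPST.subtype_of_headTyped_charProc hT hT'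
      (h.headTyped_hnf (MPST.guarded_charProc hT.guarded))
  exact ⟨⟨fun h P hP => ⟨hP.1, hP.2.sub h hT'⟩,
    fun h => key (h (MPST.charProc_mem_denotation hT)).2⟩, key⟩
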